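/- **Theorem (third Cauchy formula).** Let $(M,\omega)$ be a compact Kähler manifold of complex dimension $n$ and $(L,h)$ a quantum line bundle on it: a holomorphic line bundle with a smooth hermitian metric $h$ (conjugate linear in the first argument) whose connection $\nabla=\partial+\partial\log\hat h+\bar\partial$ compatible with $h$ and the complex structure has curvature $F=\bar\partial\partial\log\hat h=-\mathrm{i}\,\omega$. Assume that $L$ is very ample, i.e. its global holomorphic sections define an embedding of $M$ into a projective space. Let $\langle\varphi,\psi\rangle_L=\int_M h(\varphi,\psi)\,\Omega$ with $\Omega$ the positive volume form $\omega^n/n!$, and let $s_0,\dots,s_N$ be an orthonormal basis of the space $\Gamma_{hol}(M,L)$ for this scalar product. For $0\neq q\in L_x$ define $\hat q(s)\in\mathbb{C}$ by $s(x)=\hat q(s)\,q$. Then there is exactly one coherent vector $e_q\in\Gamma_{hol}(M,L)$ with $\langle e_q,s\rangle_L=\hat q(s)$ for all $s\in\Gamma_{hol}(M,L)$. For a section $s$ of $L$ and points $x,y$ with $s(x)\ne0\ne s(y)$ put $\langle e_x,e_y\rangle_s:=\langle e_{s(x)},e_{s(y)}\rangle_L$. Make the same definitions on $\mathbb{P}^N(\mathbb{C})$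 with the Fubini–Study form, given in the affine charts by $\omega_{FS}=\mathrm{i}\,\frac{(1+\|w\|^2)\sum_i dw_i\wedge d\bar w_i-\sum_{i,j}\bar w_iw_j\,dw_i\wedge d\bar w_j}{(1+\|w\|^2)^2}$, and with the hyperplane bundle $H$, metrized by $|\alpha|^2([z])=|\alpha(z)|^2/\|z\|^2$ for linear forms $\alpha$; here too the coherent vectors exist and are unique. Let $\mathrm{vol}(\mathbb{P}^N)$ be the volume with respect to $\omega_{FS}^N/N!$. Let $i:M\to\mathbb{P}^N(\mathbb{C})$, $x\mapsto(s_0(x):\dots:s_N(x))$, be the holomorphic coherent state embedding and identify $i^*H\cong L$ so that the linear form $Z_j$ pulls back to $s_j$ for every $j$. Then for every holomorphic section $t\not\equiv0$ of $H$ and all $x,y\in M$ with $t(i(x))\neq0$ and $t(i(y))\neq0$, $$\langle e_x,e_y\rangle_{i^*(t)}=\frac{\mathrm{vol}(\mathbb{P}^N)}{N+1}\,\langle e_{i(x)},e_{i(y)}\rangle_{t}\,.$$ -/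

import Mathlib

open Manifold Bundle Topology MeasureTheory
open scoped Manifold ContDiff Bundle LinearAlgebra.Projectivization ComplexConjugate

noncomputable section

namespace CoherentStates

/-- Complex projective space `ℙ^N(ℂ)`. -/
def CP (N : ℕ) : Type := ℙ ℂ (Fin (N + 1) → ℂ)

namespace CP

variable {N : ℕ}

/-- The point `(z_0 : ... : z_N)`. -/
def mk (z : Fin (N + 1) → ℂ) (hz : z ≠ 0) : CP N := Projectivization.mk ℂ z hz

/-- A choice of homogeneous coordinates of a point. -/
def rep (p : CP N) : Fin (N + 1) → ℂ := Projectivization.rep p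

theorem rep_ne_zero (p : CP N) : p.rep ≠ 0 := Projectivization.rep_nonzero p

theorem mk_rep (p : CP N) : mk p.rep p.rep_ne_zero = p := Projectivization.mk_rep p

theorem mk_eq_mk_iff (z w : Fin (N + 1) → ℂ) (hz : z ≠ 0) (hw : w ≠ 0) :
    mk z hz = mk w hw ↔ ∃ a : ℂ, a • w = z :=
  Projectivization.mk_eq_mk_iff' ℂ z w hz hw

theorem exists_smul_rep (z : Fin (N + 1) → ℂ) (hz : z ≠ 0) :
    ∃ a : ℂ, a ≠ 0 ∧ (mk z hz).rep = a • z := by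
  obtain ⟨a, ha⟩ := Projectivization.exists_smul_eq_mk_rep ℂ z hz
  exact ⟨a, a.ne_zero, ha.symm⟩

/-- The quotient topology of `ℂ^{N+1} ∖ {0}`. -/
instance : TopologicalSpace (CP N) :=
  TopologicalSpace.coinduced
    (fun z : {z : Fin (N + 1) → ℂ // z ≠ 0} => mk z.1 z.2) inferInstance

instance : MeasurableSpace (CP N) := borel (CP N)

instance : BorelSpace (CP N) := ⟨rfl⟩

theorem isQuotientMap_mk :
    IsQuotientMap (fun z : {z : Fin (N + 1) → ℂ // z ≠ 0} => mk z.1 z.2) :=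
  ⟨⟨rfl⟩, fun p => ⟨⟨p.rep, p.rep_ne_zero⟩, p.mk_rep⟩⟩

/-- The ratio `z_i / z_j` of homogeneous coordinates. -/
def ratio (i j : Fin (N + 1)) (p : CP N) : ℂ := p.rep i / p.rep j

/-- The domain `V_k = {z_k ≠ 0}` of the `k`-th affine chart. -/
def affine (k : Fin (N + 1)) : Set (CP N) := {p | p.rep k ≠ 0}

theorem ratio_mk (i j : Fin (N + 1)) (z : Fin (N + 1) → ℂ) (hz : z ≠ 0) :
    ratio i j (mk z hz) = z i / z j := by
  obtain ⟨a, ha, h⟩ := exists_smul_rep z hz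
  simp only [ratio, h, Pi.smul_apply, smul_eq_mul]
  rw [mul_div_mul_left _ _ ha]

theorem mk_mem_affine (k : Fin (N + 1)) (z : Fin (N + 1) → ℂ) (hz : z ≠ 0) :
    mk z hz ∈ affine k ↔ z k ≠ 0 := by
  obtain ⟨a, ha, h⟩ := exists_smul_rep z hz
  simp [affine, h, ha]

theorem isOpen_affine (k : Fin (N + 1)) : IsOpen (affine (N := N) k) := by
  rw [← isQuotientMap_mk.isOpen_preimage]
  have : ((fun z : {z : Fin (N + 1) → ℂ // z ≠ 0} => mk z.1 z.2) ⁻¹' affine k)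
      = {z | z.1 k ≠ 0} := by
    ext z
    exact mk_mem_affine k z.1 z.2
  rw [this]
  exact isOpen_ne_fun ((continuous_apply k).comp continuous_subtype_val) continuous_const

theorem exists_mem_affine (p : CP N) : ∃ k, p ∈ affine k := by
  by_contra! h
  exact p.rep_ne_zero (funext fun k => by simpa [affine] using h k)

theorem continuousOn_ratio (i j : Fin (N + 1)) : ContinuousOn (ratio (N := N) i j) (affine j) := by
  rw [isQuotientMap_mk.continuousOn_isOpen_iff (isOpen_affine j)]
  have h : ∀ z : {z : Fin (N + 1) → ℂ // z ≠ 0}, ratio i j (mk z.1 z.2) = z.1 i / z.1 j :=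
    fun z => ratio_mk i j z.1 z.2
  have hc : ∀ l, Continuous fun z : {z : Fin (N + 1) → ℂ // z ≠ 0} => z.1 l :=
    fun l => (continuous_apply l).comp continuous_subtype_val
  refine ContinuousOn.congr (f := fun z : {z : Fin (N + 1) → ℂ // z ≠ 0} => z.1 i / z.1 j) ?_
    fun z _ => h z
  refine ContinuousOn.div (hc i).continuousOn (hc j).continuousOn fun z hz => ?_
  exact (mk_mem_affine j z.1 z.2).1 hz

/-- The vector with `k`-th entry `1` and remaining entries `w`. -/
def lift (k : Fin (N + 1)) (w : Fin N → ℂ) : Fin (N + 1) → ℂ := k.insertNth (α := fun _ => ℂ) 1 w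

theorem lift_self (k : Fin (N + 1)) (w : Fin N → ℂ) : lift k w k = 1 := by simp [lift]

theorem lift_succAbove (k : Fin (N + 1)) (w : Fin N → ℂ) (j : Fin N) :
    lift k w (k.succAbove j) = w j := by simp [lift]

theorem lift_ne_zero (k : Fin (N + 1)) (w : Fin N → ℂ) : lift k w ≠ 0 := fun h => by
  have := congrFun h k
  simp [lift_self] at this

theorem contDiff_lift (𝕜 : Type*) [NontriviallyNormedField 𝕜] [NormedAlgebra 𝕜 ℂ]
    (m : WithTop ℕ∞) (k i : Fin (N + 1)) :
    ContDiff 𝕜 m fun w : Fin N → ℂ => lift k w i := by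
  rcases Fin.eq_self_or_eq_succAbove k i with rfl | ⟨j, rfl⟩
  · simpa only [lift_self] using contDiff_const
  · simpa only [lift_succAbove] using contDiff_apply 𝕜 ℂ j

theorem continuous_lift (k : Fin (N + 1)) : Continuous (lift (N := N) k) :=
  continuous_pi fun i => (contDiff_lift ℂ 0 k i).continuous

/-- The affine chart on `V_k`, with coordinates the ratios `z_i / z_k` for `i ≠ k`. -/
def chart (k : Fin (N + 1)) : OpenPartialHomeomorph (CP N) (Fin N → ℂ) where
  toFun p j := ratio (k.succAbove j) k p
  invFun w := mk (lift k w) (lift_ne_zero k w)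
  source := affine k
  target := Set.univ
  map_source' _ _ := Set.mem_univ _
  map_target' w _ := by
    rw [mk_mem_affine, lift_self]
    exact one_ne_zero
  left_inv' p hp := by
    have hk : p.rep k ≠ 0 := hp
    conv_rhs => rw [← p.mk_rep]
    rw [mk_eq_mk_iff]
    refine ⟨(p.rep k)⁻¹, ?_⟩
    ext i
    rcases Fin.eq_self_or_eq_succAbove k i with rfl | ⟨j, rfl⟩
    · simp [lift_self, hk]
    · simp [lift_succAbove, ratio, div_eq_inv_mul]
  right_inv' w _ := by
    ext j
    simp [ratio_mk, lift_self, lift_succAbove]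
  open_source := isOpen_affine k
  open_target := isOpen_univ
  continuousOn_toFun := continuousOn_pi.2 fun j => continuousOn_ratio _ _
  continuousOn_invFun :=
    (isQuotientMap_mk.continuous.comp
      ((continuous_lift k).subtype_mk (lift_ne_zero k))).continuousOn

/-- The index of the affine chart used at a point. -/
def index (p : CP N) : Fin (N + 1) := (exists_mem_affine p).choose

theorem mem_affine_index (p : CP N) : p ∈ affine p.index := (exists_mem_affine p).choose_spec

instance : ChartedSpace (Fin N → ℂ) (CP N) where
  atlas := Set.range chart
  chartAt p := chart p.index
  mem_chart_source := mem_affine_index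
  chart_mem_atlas p := ⟨p.index, rfl⟩

theorem contDiffOn_ratio (𝕜 : Type*) [NontriviallyNormedField 𝕜] [NormedAlgebra 𝕜 ℂ]
    (m : WithTop ℕ∞) (k i j : Fin (N + 1)) :
    ContDiffOn 𝕜 m (fun w : Fin N → ℂ => ratio i j ((chart k).symm w)) {w | lift k w j ≠ 0} := by
  have h : ∀ w : Fin N → ℂ, ratio i j ((chart k).symm w) = lift k w i * (lift k w j)⁻¹ := by
    intro w
    rw [← div_eq_mul_inv]
    exact ratio_mk i j _ (lift_ne_zero k w)
  simp_rw [h]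
  exact (contDiff_lift 𝕜 m k i).contDiffOn.mul ((contDiff_lift 𝕜 m k j).contDiffOn.inv fun w hw => hw)

theorem isManifold (𝕜 : Type*) [NontriviallyNormedField 𝕜] [NormedAlgebra 𝕜 ℂ]
    (m : WithTop ℕ∞) : IsManifold 𝓘(𝕜, Fin N → ℂ) m (CP N) := by
  refine isManifold_of_contDiffOn _ _ _ ?_
  rintro _ _ ⟨k, rfl⟩ ⟨l, rfl⟩
  simp only [modelWithCornersSelf_coe, modelWithCornersSelf_coe_symm, Function.comp_id,
    Function.id_comp, Set.preimage_id_eq, id_eq, Set.range_id, Set.inter_univ]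
  have h : ContDiffOn 𝕜 m (fun w j => ratio (l.succAbove j) l ((chart k).symm w))
      {w : Fin N → ℂ | lift k w l ≠ 0} :=
    contDiffOn_pi.2 fun j => contDiffOn_ratio 𝕜 m k _ _
  refine h.mono ?_
  intro w hw
  have h2 := hw.2
  exact (mk_mem_affine l _ (lift_ne_zero k w)).1 h2

instance : IsManifold 𝓘(ℂ, Fin N → ℂ) ω (CP N) := isManifold ℂ ω

theorem contMDiffOn_ratio (𝕜 : Type*) [NontriviallyNormedField 𝕜] [NormedAlgebra 𝕜 ℂ]
    (m : WithTop ℕ∞) (i j : Fin (N + 1)) :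
    ContMDiffOn 𝓘(𝕜, Fin N → ℂ) 𝓘(𝕜, ℂ) m (ratio i j) (affine j) := by
  have := isManifold (N := N) 𝕜 m
  have h1 : ContMDiffOn 𝓘(𝕜, Fin N → ℂ) 𝓘(𝕜, Fin N → ℂ) m (chart j) (affine j) :=
    contMDiffOn_of_mem_maximalAtlas (e := chart j)
      (IsManifold.subset_maximalAtlas ⟨j, rfl⟩)
  have h2 := (contDiffOn_ratio (N := N) 𝕜 m j i j).contMDiffOn
  have h3 := h2.comp h1 fun p hp => by
    simp [lift_self]
  refine h3.congr fun p hp => ?_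
  simp only [Function.comp]
  rw [(chart j).left_inv hp]

variable (N) in
/-- The hyperplane bundle `H` (the dual of the tautological bundle) over `ℙ^N`: over `V_i` it has
the frame given by the linear form `Z_i`, and `Z_i = (z_i / z_j) Z_j` over `V_i ∩ V_j`. -/
def hyperplaneCore : VectorBundleCore ℂ (CP N) ℂ (Fin (N + 1)) where
  baseSet := affine
  isOpen_baseSet := isOpen_affine
  indexAt := index
  mem_baseSet_at := mem_affine_index
  coordChange i j p := ratio i j p • ContinuousLinearMap.id ℂ ℂ
  coordChange_self i p hp v := by
    have : p.rep i ≠ 0 := hp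
    simp [ratio, this]
  continuousOn_coordChange i j :=
    ((continuousOn_ratio i j).mono Set.inter_subset_right).smul continuousOn_const
  coordChange_comp i j k p hp v := by
    have hj : p.rep j ≠ 0 := hp.1.2
    simp only [ratio, smul_apply, ContinuousLinearMap.id_apply, smul_eq_mul]
    field_simp

instance : (hyperplaneCore N).IsContMDiff 𝓘(ℂ, Fin N → ℂ) ω where
  contMDiffOn_coordChange i j :=
    ((contMDiffOn_ratio ℂ ω i j).mono Set.inter_subset_right).smul contMDiffOn_const

variable (N) in
/-- The fibres of the hyperplane bundle. -/
abbrev H : CP N → Type := (hyperplaneCore N).Fiber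

/-- The fibre of `H` at `p` is the dual of the line `p`: the value of `v : H N p` at a vector `z`
of the line `p`. The frame `Z_k`, `k = index p`, corresponds to `1 : ℂ`. -/
def pairing {p : CP N} (v : H N p) (z : Fin (N + 1) → ℂ) : ℂ := (show ℂ from v) * z p.index

/-- The linear form `Z_j`, as a section of the hyperplane bundle. -/
def coordSection (j : Fin (N + 1)) (p : CP N) : H N p := (show H N p from ratio j p.index p)

theorem pairing_coordSection (j : Fin (N + 1)) (z : Fin (N + 1) → ℂ) (hz : z ≠ 0) :
    pairing (coordSection j (mk z hz)) z = z j := by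
  have h : mk z hz ∈ affine (mk z hz).index := mem_affine_index _
  rw [mk_mem_affine] at h
  change ratio j (mk z hz).index (mk z hz) * z (mk z hz).index = z j
  rw [ratio_mk]
  field_simp

end CP
section General

variable {n : ℕ} {M : Type*} [TopologicalSpace M] [ChartedSpace (Fin n → ℂ) M]

section Kahler

variable (n M) in
/-- Real bilinear forms on the tangent spaces of a complex manifold. -/
abbrev TwoForm : Type _ :=
  ∀ x : M, TangentSpace 𝓘(ℝ, Fin n → ℂ) x →ₗ[ℝ] TangentSpace 𝓘(ℝ, Fin n → ℂ) x →ₗ[ℝ] ℝ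

/-- The coordinate expression of a form in a chart `e`: its value at `e.symm y` on the tangent
vectors with coordinates `u` and `v`. -/
def TwoForm.inChart (κ : TwoForm n M) (e : OpenPartialHomeomorph M (Fin n → ℂ))
    (y u v : Fin n → ℂ) : ℝ :=
  κ (e.symm y) (mfderiv 𝓘(ℝ, Fin n → ℂ) 𝓘(ℝ, Fin n → ℂ) e.symm y u)
    (mfderiv 𝓘(ℝ, Fin n → ℂ) 𝓘(ℝ, Fin n → ℂ) e.symm y v)

/-- Kähler forms: smooth closed real `2`-forms `κ`, invariant under the complex structure, with
`κ(u, iu) > 0` for `u ≠ 0`. -/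
structure IsKahlerForm (κ : TwoForm n M) : Prop where
  alternating : ∀ (x : M) (u : TangentSpace 𝓘(ℝ, Fin n → ℂ) x), κ x u u = 0
  invariant : ∀ (x : M) (u v : Fin n → ℂ), κ x (Complex.I • u) (Complex.I • v) = κ x u v
  positive : ∀ (x : M) (u : Fin n → ℂ), u ≠ 0 → 0 < κ x u (Complex.I • u)
  smooth : ∀ e ∈ atlas (Fin n → ℂ) M, ∀ u v : Fin n → ℂ,
    ContDiffOn ℝ ∞ (fun y => κ.inChart e y u v) e.target
  closed : ∀ e ∈ atlas (Fin n → ℂ) M, ∀ y ∈ e.target, ∀ u v w : Fin n → ℂ,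
    fderiv ℝ (fun y => κ.inChart e y v w) y u - fderiv ℝ (fun y => κ.inChart e y u w) y v
      + fderiv ℝ (fun y => κ.inChart e y u v) y w = 0

/-- The coefficients `g_{jk}` in a chart, where `κ = i ∑ g_{jk} dz_j ∧ d\bar z_k`. -/
def TwoForm.coeffMatrix (κ : TwoForm n M) (e : OpenPartialHomeomorph M (Fin n → ℂ))
    (y : Fin n → ℂ) : Matrix (Fin n) (Fin n) ℂ :=
  Matrix.of fun j k =>
    ((κ.inChart e y (Pi.single j 1) (Complex.I • Pi.single k 1) : ℝ) -
      Complex.I * (κ.inChart e y (Pi.single j 1) (Pi.single k 1) : ℝ)) / 2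

/-- The measure on the domain of a chart given there by the volume form `κ^n / n!`, which is
`det (g_{jk}) ∏_j (i dz_j ∧ d\bar z_j) = 2^n det (g_{jk}) dλ` with `λ` the Lebesgue measure. -/
def TwoForm.chartMeasure [MeasurableSpace M] (κ : TwoForm n M)
    (e : OpenPartialHomeomorph M (Fin n → ℂ)) : Measure M :=
  (((volume : Measure (Fin n → ℂ)).restrict e.target).withDensity
    fun y => ENNReal.ofReal (2 ^ n * (κ.coeffMatrix e y).det.re)).map e.symm

/-- The measure on `M` given by the volume form `κ^n / n!`. The measures defined by the charts
agree where the domains of the charts overlap; the measure obtained by glueing them is the least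
measure that dominates all of them. -/
def TwoForm.volumeMeasure [MeasurableSpace M] (κ : TwoForm n M) : Measure M :=
  ⨆ e ∈ atlas (Fin n → ℂ) M, κ.chartMeasure e

end Kahler

variable {L : M → Type*} [∀ x, AddCommGroup (L x)] [∀ x, Module ℂ (L x)]
  [TopologicalSpace (TotalSpace ℂ L)] [∀ x, TopologicalSpace (L x)]
  [FiberBundle ℂ L] [VectorBundle ℂ ℂ L]

variable (n L) in
/-- The space of global holomorphic sections of a line bundle `L`. -/
abbrev HolSection : Type _ := Cₛ^ω⟮𝓘(ℂ, Fin n → ℂ); ℂ, L⟯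

variable (L) in
/-- The local holomorphic frame of `L` defined by the preferred trivialization at `x₀`. -/
def frame (x₀ x : M) : L x := (trivializationAt ℂ L x₀).symm x 1

variable (n L) in
/-- Smooth hermitian metrics on a holomorphic line bundle, conjugate linear in the first
argument. -/
structure HermitianMetric where
  inner : ∀ x, L x →ₗ⋆[ℂ] L x →ₗ[ℂ] ℂ
  conj_symm : ∀ (x : M) (v w : L x), conj (inner x v w) = inner x w v
  positive : ∀ (x : M) (v : L x), v ≠ 0 → 0 < (inner x v v).re
  smooth : ∀ x₀ : M, ContMDiffOn 𝓘(ℝ, Fin n → ℂ) 𝓘(ℝ, ℝ) ∞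
    (fun x => (inner x (frame L x₀ x) (frame L x₀ x)).re) (trivializationAt ℂ L x₀).baseSet

/-- The function `log ĥ` near `x`, in the preferred chart and the preferred frame at `x`. -/
def HermitianMetric.logLocal (h : HermitianMetric n L) (x : M) (y : Fin n → ℂ) : ℝ :=
  Real.log (h.inner ((chartAt (Fin n → ℂ) x).symm y) (frame L x ((chartAt (Fin n → ℂ) x).symm y))
    (frame L x ((chartAt (Fin n → ℂ) x).symm y))).re

/-- The form `θ = ∂ log ĥ` of the connection `∇ = ∂ + ∂ log ĥ + \bar∂` compatible with the metric
and the complex structure, in the preferred chart and the preferred frame at `x`. -/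
def HermitianMetric.connectionForm (h : HermitianMetric n L) (x : M) (y u : Fin n → ℂ) : ℂ :=
  ((fderiv ℝ (h.logLocal x) y u : ℝ) -
    Complex.I * (fderiv ℝ (h.logLocal x) y (Complex.I • u) : ℝ)) / 2

/-- The curvature `F = dθ = \bar∂∂ log ĥ` of that connection, on tangent vectors at `x`. -/
def HermitianMetric.curvature (h : HermitianMetric n L) (x : M)
    (u v : TangentSpace 𝓘(ℝ, Fin n → ℂ) x) : ℂ :=
  fderiv ℝ (fun y => h.connectionForm x y v) (chartAt (Fin n → ℂ) x x) u -
    fderiv ℝ (fun y => h.connectionForm x y u) (chartAt (Fin n → ℂ) x x) v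

/-- The quantum condition `F = -i κ`. -/
def IsQuantum (κ : TwoForm n M) (h : HermitianMetric n L) : Prop :=
  ∀ (x : M) (u v : TangentSpace 𝓘(ℝ, Fin n → ℂ) x), h.curvature x u v = -Complex.I * κ x u v

/-- The scalar product `∫ h(φ, ψ) Ω` of sections of `L`, with the volume form `Ω` of `κ`. -/
def sectionInner [MeasurableSpace M] (κ : TwoForm n M) (h : HermitianMetric n L)
    (φ ψ : ∀ x, L x) : ℂ :=
  ∫ x, h.inner x (φ x) (ψ x) ∂κ.volumeMeasure

/-- The scalar `c` with `v = c • q`, for vectors `q ≠ 0` and `v` of the same fibre. -/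
def quotient {x : M} (q v : L x) : ℂ :=
  (trivializationAt ℂ L x ⟨x, v⟩).2 / (trivializationAt ℂ L x ⟨x, q⟩).2

theorem fibre_coord_smul {x : M} (c : ℂ) (v : L x) :
    (trivializationAt ℂ L x ⟨x, c • v⟩).2 = c * (trivializationAt ℂ L x ⟨x, v⟩).2 :=
  ((trivializationAt ℂ L x).linear ℂ (FiberBundle.mem_baseSet_trivializationAt' x)).map_smul c v

theorem fibre_coord_injective {x : M} :
    Function.Injective fun v : L x => (trivializationAt ℂ L x ⟨x, v⟩).2 :=
  ((trivializationAt ℂ L x).continuousLinearEquivAt ℂ x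
    (FiberBundle.mem_baseSet_trivializationAt' x)).injective

theorem fibre_coord_ne_zero {x : M} {q : L x} (hq : q ≠ 0) :
    (trivializationAt ℂ L x ⟨x, q⟩).2 ≠ 0 := fun h => hq <| by
  apply fibre_coord_injective
  have h0 := fibre_coord_smul (L := L) (x := x) 0 0
  simp only [zero_smul, zero_mul] at h0
  simp only [h, h0]

theorem quotient_smul {x : M} {q : L x} (hq : q ≠ 0) (v : L x) : quotient q v • q = v := by
  apply fibre_coord_injective
  simp only [fibre_coord_smul, quotient]
  exact div_mul_cancel₀ _ (fibre_coord_ne_zero hq)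

theorem frame_ne_zero (x : M) : frame L x x ≠ 0 := fun h => by
  have h1 : (trivializationAt ℂ L x ⟨x, frame L x x⟩).2 = 1 := by
    rw [frame, (trivializationAt ℂ L x).apply_mk_symm
      (FiberBundle.mem_baseSet_trivializationAt' x)]
  have h0 := fibre_coord_smul (L := L) (x := x) 0 0
  simp only [zero_smul, zero_mul] at h0
  rw [h, h0] at h1
  exact zero_ne_one h1

/-- The linear form `q̂` on sections, defined by `s x = q̂(s) • q` for `0 ≠ q ∈ L x`. -/
def qHat {x : M} (q : L x) (s : HolSection n L) : ℂ := quotient q (s x)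

/-- The defining property `⟨e, s⟩ = q̂(s)` for all holomorphic `s` of the coherent vector `e = e_q`
of `0 ≠ q ∈ L x`. -/
def IsCoherentVector [MeasurableSpace M] (κ : TwoForm n M) (h : HermitianMetric n L)
    {x : M} (q : L x) (e : HolSection n L) : Prop :=
  ∀ s : HolSection n L, sectionInner κ h e s = qHat q s

open Classical in
/-- The coherent vector `e_q` of `0 ≠ q ∈ L x`. -/
def coherentVector [MeasurableSpace M] (κ : TwoForm n M) (h : HermitianMetric n L)
    {x : M} (q : L x) : HolSection n L :=
  if H : ∃ e, IsCoherentVector κ h q e then H.choose else 0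

/-- The scalar product `⟨e_x, e_y⟩_s = ⟨e_{s(x)}, e_{s(y)}⟩` of the coherent vectors at `x` and
`y` with respect to a section `s` as frame, for `s(x) ≠ 0` and `s(y) ≠ 0`. -/
def coherentInner [MeasurableSpace M] (κ : TwoForm n M) (h : HermitianMetric n L)
    (s : ∀ x, L x) (x y : M) : ℂ :=
  sectionInner κ h (coherentVector κ h (s x)) (coherentVector κ h (s y))

/-- The vector `(q̂(s_0), ..., q̂(s_N))`. -/
def homCoord {N : ℕ} (s : Fin (N + 1) → HolSection n L) {x : M} (q : L x) : Fin (N + 1) → ℂ :=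
  fun j => qHat q (s j)

variable (n L) in
/-- The holomorphic sections of `L` have no common zero. -/
def BasePointFree : Prop := ∀ x : M, ∃ s : HolSection n L, s x ≠ 0

theorem homCoord_ne_zero {N : ℕ} [ContMDiffVectorBundle ω ℂ L 𝓘(ℂ, Fin n → ℂ)]
    (hL : BasePointFree n L)
    (s : Module.Basis (Fin (N + 1)) ℂ (HolSection n L)) {x : M} {q : L x} (hq : q ≠ 0) :
    homCoord s q ≠ 0 := fun h => by
  obtain ⟨t, ht⟩ := hL x
  have h0 : ∀ j, s j x = 0 := fun j => by
    rw [← quotient_smul hq (s j x)]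
    have : quotient q (s j x) = 0 := congrFun h j
    rw [this, zero_smul]
  apply ht
  have hev : ∀ u : HolSection n L, u ∈ Submodule.span ℂ (Set.range s) → u x = 0 := by
    intro u hu
    induction hu using Submodule.span_induction with
    | mem u hu => obtain ⟨j, rfl⟩ := hu; exact h0 j
    | zero => rfl
    | add u v _ _ hu hv => rw [ContMDiffSection.coe_add, Pi.add_apply, hu, hv, add_zero]
    | smul c u _ hu => rw [ContMDiffSection.coe_smul, Pi.smul_apply, hu, smul_zero]
  exact hev t (by rw [s.span_eq]; trivial)

/-- The map `x ↦ (s_0(x) : ... : s_N(x))` to projective space defined by a basis of the space of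
holomorphic sections. It is the (holomorphic) coherent state embedding if the basis is
orthonormal. -/
def projMap {N : ℕ} [ContMDiffVectorBundle ω ℂ L 𝓘(ℂ, Fin n → ℂ)]
    (hL : BasePointFree n L)
    (s : Module.Basis (Fin (N + 1)) ℂ (HolSection n L)) (x : M) : CP N :=
  CP.mk (homCoord s (frame L x x)) (homCoord_ne_zero hL s (frame_ne_zero x))

theorem homCoord_smul {N : ℕ} (s : Fin (N + 1) → HolSection n L) {x : M} {q : L x} (hq : q ≠ 0)
    {c : ℂ} (hc : c ≠ 0) : homCoord s q = c • homCoord s (c • q) := by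
  ext j
  simp only [homCoord, qHat, quotient, Pi.smul_apply, smul_eq_mul, fibre_coord_smul]
  have := fibre_coord_ne_zero hq
  field_simp

theorem projMap_eq {N : ℕ} [ContMDiffVectorBundle ω ℂ L 𝓘(ℂ, Fin n → ℂ)]
    (hL : BasePointFree n L) (s : Module.Basis (Fin (N + 1)) ℂ (HolSection n L)) (x : M)
    {q : L x} (hq : q ≠ 0) :
    projMap hL s x = CP.mk (homCoord s q) (homCoord_ne_zero hL s hq) := by
  rw [projMap, CP.mk_eq_mk_iff]
  have h := quotient_smul (frame_ne_zero x) q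
  have hc : quotient (frame L x x) q ≠ 0 := fun h0 => hq (by rw [← h, h0, zero_smul])
  refine ⟨quotient (frame L x x) q, ?_⟩
  rw [homCoord_smul s (frame_ne_zero x) hc, h]

variable (n L) in
/-- Very ample line bundles: the sections of `L` define a holomorphic embedding of `M` into a
projective space. -/
structure IsVeryAmple [ContMDiffVectorBundle ω ℂ L 𝓘(ℂ, Fin n → ℂ)] : Prop where
  basePointFree : BasePointFree n L
  embedding : ∃ (N : ℕ) (s : Module.Basis (Fin (N + 1)) ℂ (HolSection n L)),
    IsSmoothEmbedding 𝓘(ℂ, Fin n → ℂ) 𝓘(ℂ, Fin N → ℂ) ω (projMap basePointFree s)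

/-- The pullback to `L` of a section `t` of the hyperplane bundle under `i = projMap hL s`. The
fibres of `i^*H` and `L` at `x` are identified by `α ↦ α(φ(q)) • q`, where `0 ≠ q ∈ L x`,
`φ(q) = (q̂(s_0), ..., q̂(s_N))` is a vector of the line `i(x)` and `α` a linear form on this line. -/
def pullbackSection {N : ℕ} [ContMDiffVectorBundle ω ℂ L 𝓘(ℂ, Fin n → ℂ)]
    (hL : BasePointFree n L) (s : Module.Basis (Fin (N + 1)) ℂ (HolSection n L))
    (t : ∀ p, CP.H N p) (x : M) : L x :=
  CP.pairing (t (projMap hL s x)) (homCoord s (frame L x x)) • frame L x x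

/-- The linear form `Z_j` is pulled back to `s_j`. -/
theorem pullbackSection_coordSection {N : ℕ} [ContMDiffVectorBundle ω ℂ L 𝓘(ℂ, Fin n → ℂ)]
    (hL : BasePointFree n L) (s : Module.Basis (Fin (N + 1)) ℂ (HolSection n L))
    (j : Fin (N + 1)) (x : M) :
    pullbackSection hL s (CP.coordSection j) x = s j x := by
  rw [pullbackSection]
  have h := CP.pairing_coordSection j (homCoord s (frame L x x))
    (homCoord_ne_zero hL s (frame_ne_zero x))
  change CP.pairing (CP.coordSection j (CP.mk _ _)) _ • _ = _
  rw [h]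
  exact quotient_smul (frame_ne_zero x) (s j x)

end General

namespace CP

variable {N : ℕ}

/-- The coefficient form `g(u, v)` of the Fubini-Study form `i ∑ g_{jk} dw_j ∧ d\bar w_k` at the
point `w` of an affine chart. -/
def fsHermitian (w u v : Fin N → ℂ) : ℂ :=
  ((1 + ∑ i, ‖w i‖ ^ 2 : ℝ) * (∑ i, u i * conj (v i)) -
    (∑ i, conj (w i) * u i) * ∑ j, w j * conj (v j)) / (1 + ∑ i, ‖w i‖ ^ 2 : ℝ) ^ 2

/-- The Fubini-Study form at the point `w` of an affine chart, where
`i (dw_j ∧ d\bar w_k)(u, v) = i (u_j \bar v_k - v_j \bar u_k)`. -/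
def fsForm (w : Fin N → ℂ) : (Fin N → ℂ) →ₗ[ℝ] (Fin N → ℂ) →ₗ[ℝ] ℝ :=
  LinearMap.mk₂ ℝ
    (fun u v => (Complex.I * (fsHermitian w u v - fsHermitian w v u)).re)
    (fun u u' v => by
      rw [← Complex.add_re]; congr 1
      simp only [fsHermitian, Pi.add_apply, map_add, mul_add, add_mul, Finset.sum_add_distrib]
      ring)
    (fun c u v => by
      rw [smul_eq_mul, ← Complex.re_ofReal_mul]; congr 1
      simp only [fsHermitian, Pi.smul_apply, Complex.real_smul, map_mul, Complex.conj_ofReal,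
        mul_left_comm _ (c : ℂ), mul_assoc, ← Finset.mul_sum]
      ring)
    (fun u v v' => by
      rw [← Complex.add_re]; congr 1
      simp only [fsHermitian, Pi.add_apply, map_add, mul_add, add_mul, Finset.sum_add_distrib]
      ring)
    (fun c u v => by
      rw [smul_eq_mul, ← Complex.re_ofReal_mul]; congr 1
      simp only [fsHermitian, Pi.smul_apply, Complex.real_smul, map_mul, Complex.conj_ofReal,
        mul_left_comm _ (c : ℂ), mul_assoc, ← Finset.mul_sum]
      ring)

variable (N) in
/-- The Fubini-Study form on `ℙ^N`. -/
def fubiniStudy : TwoForm N (CP N) := fun p => fsForm (chartAt (Fin N → ℂ) p p)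

/-- The value at `p` of the squared norm of the linear form `Z_k`. -/
def normSqCoord (k : Fin (N + 1)) (p : CP N) : ℝ := ‖p.rep k‖ ^ 2 / ∑ i, ‖p.rep i‖ ^ 2

theorem sum_normSq_rep_pos (p : CP N) : 0 < ∑ i, ‖p.rep i‖ ^ 2 := by
  obtain ⟨k, hk⟩ := exists_mem_affine p
  refine Finset.sum_pos' (fun i _ => by positivity) ⟨k, Finset.mem_univ k, ?_⟩
  have : p.rep k ≠ 0 := hk
  positivity

theorem contMDiffOn_normSqCoord (k : Fin (N + 1)) :
    ContMDiffOn 𝓘(ℝ, Fin N → ℂ) 𝓘(ℝ, ℝ) ∞ (normSqCoord (N := N) k) (affine k) := by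
  have h1 : ContMDiffOn 𝓘(ℝ, Fin N → ℂ) 𝓘(ℝ, Fin (N + 1) → ℂ) ∞
      (fun (p : CP N) i => ratio i k p) (affine k) :=
    contMDiffOn_pi_space.2 fun i => contMDiffOn_ratio ℝ ∞ i k
  have h2 : ContDiffOn ℝ ∞ (fun z : Fin (N + 1) → ℂ => (∑ i, ‖z i‖ ^ 2)⁻¹) {z | z ≠ 0} := by
    refine ContDiffOn.inv (ContDiffOn.sum fun i _ =>
      ((contDiff_apply ℝ ℂ i).norm_sq ℝ).contDiffOn) fun z hz h => hz ?_
    ext i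
    rw [Finset.sum_eq_zero_iff_of_nonneg fun i _ => by positivity] at h
    simpa using h i (Finset.mem_univ i)
  refine (h2.contMDiffOn.comp h1 fun p hp h => ?_).congr fun p hp => ?_
  · have hk : p.rep k ≠ 0 := hp
    have := congrFun h k
    simp [ratio, hk] at this
  · have hk : p.rep k ≠ 0 := hp
    simp only [Function.comp, normSqCoord, ratio, norm_div, div_pow, ← Finset.sum_div, inv_div]

/-- The hermitian form `(v, w) ↦ \bar v w r` on `ℂ`. -/
def scaledInner (r : ℝ) : ℂ →ₗ⋆[ℂ] ℂ →ₗ[ℂ] ℂ :=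
  LinearMap.mk₂'ₛₗ (starRingEnd ℂ) (RingHom.id ℂ) (fun v w => conj v * w * (r : ℂ))
    (fun v v' w => by simp only [map_add]; ring)
    (fun c v w => by simp only [smul_eq_mul, map_mul]; ring)
    (fun v w w' => by ring)
    (fun c v w => by simp only [smul_eq_mul, RingHom.id_apply]; ring)

theorem scaledInner_apply (r : ℝ) (v w : ℂ) : scaledInner r v w = conj v * w * (r : ℂ) := rfl

theorem scaledInner_self (r : ℝ) (v : ℂ) : (scaledInner r v v).re = ‖v‖ ^ 2 * r := by
  rw [scaledInner_apply, ← Complex.normSq_eq_conj_mul_self, ← Complex.ofReal_mul,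
    Complex.ofReal_re, Complex.normSq_eq_norm_sq]

variable (N) in
/-- The metric of the hyperplane bundle dual to the standard metric of the tautological bundle:
the squared norm of a linear form `α` at `[z]` is `|α(z)|² / ‖z‖²`. -/
def hyperplaneMetric : HermitianMetric N (H N) where
  inner p := scaledInner (normSqCoord p.index p)
  conj_symm p := fun (v w : ℂ) => by
    have h : ∀ r : ℝ, conj (scaledInner r v w) = scaledInner r w v := fun r => by
      simp only [scaledInner_apply, map_mul, Complex.conj_conj, Complex.conj_ofReal]
      ring
    exact h _
  positive p := fun (v : ℂ) (hv : v ≠ 0) => by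
    have hk : p.rep p.index ≠ 0 := mem_affine_index p
    have h1 : 0 < normSqCoord p.index p := div_pos (by positivity) p.sum_normSq_rep_pos
    have h2 : ∀ r : ℝ, 0 < r → 0 < (scaledInner r v v).re := fun r hr => by
      rw [scaledInner_self]
      positivity
    exact h2 _ h1
  smooth p₀ := by
    refine (contMDiffOn_normSqCoord p₀.index).congr fun p hp => ?_
    have hp' : p.rep p₀.index ≠ 0 := hp
    have hk : p.rep p.index ≠ 0 := mem_affine_index p
    have hf : frame (H N) p₀ p = (show H N p from ratio p₀.index p.index p) := by
      change ((hyperplaneCore N).localTriv p₀.index).symm p 1 = _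
      rw [(hyperplaneCore N).localTriv_symm_apply (i := p₀.index) hp]
      change ratio p₀.index p.index p • (1 : ℂ) = _
      simp
    rw [hf]
    refine (scaledInner_self _ _).trans ?_
    simp only [ratio, normSqCoord, norm_div]
    have : ‖p.rep p.index‖ ≠ 0 := norm_ne_zero_iff.2 hk
    field_simp

variable (N) in
/-- The volume of `ℙ^N` with respect to the Fubini-Study form. -/
def vol : ℝ := (fubiniStudy N).volumeMeasure.real Set.univ

end CP

end CoherentStates

end

open CoherentStates

set_option linter.unusedSectionVars false

/-! Suppose finitely many holomorphic sections b_j span and are mutually orthogonal with common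
square norm c ≠ 0. Expanding in them gives e_q = c⁻¹ ∑ conj(q̂(b_j)) b_j, and therefore ⟨e_x, e_y⟩_t
= c⁻¹ ∑ q̂(b_j) conj(q̂'(b_j)) with q = t(x), q' = t(y) (`IsOrthogonalFrame.coherentInner_eq`). This
applies to the s_j on M with c = 1 and to the linear forms Z_j on ℙ^N with c = vol(ℙ^N)/(N+1). Since
Z_j pulls back to s_j and t to i^*t, the ratios q̂ agree term by term (`qHat_pullbackSection`), so
the two sums coincide and only the factor c remains.

The substance is that the Z_j form such a family. They span (`CP.span_coordHolSection`): a section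
of H is a homogeneous function of degree one on ℂ^{N+1} ∖ {0}, bounded by C‖z‖ by compactness of the
sphere, so in an affine chart it is entire of linear growth, hence affine by Liouville.

They are orthogonal with equal norms because the Fubini-Study volume is, up to a constant, the image
of the Gaussian measure of ℂ^{N+1} (`CP.volumeMeasure_fubiniStudy`). The scalar products become
Gaussian means of conj(z_j) z_k / ‖z‖². A sign change of one coordinate kills those with j ≠ k, a
transposition identifies those with j = k, and the latter add up to the total mass. The unknown
constant enters the volume in the same way, so it is never evaluated. -/

namespace CoherentStates

/-! ### Coherent vectors from an orthogonal spanning family -/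

section CoherentVectors

variable {n : ℕ} {M : Type*} [TopologicalSpace M] [ChartedSpace (Fin n → ℂ) M]
  {L : M → Type*} [∀ x, AddCommGroup (L x)] [∀ x, Module ℂ (L x)]
  [TopologicalSpace (TotalSpace ℂ L)] [∀ x, TopologicalSpace (L x)]
  [FiberBundle ℂ L] [VectorBundle ℂ ℂ L]

theorem coord_smul_frame (x₀ : M) {x : M} (hx : x ∈ (trivializationAt ℂ L x₀).baseSet) (v : L x) :
    (trivializationAt ℂ L x₀ ⟨x, v⟩).2 • frame L x₀ x = v := by
  have h1 : frame L x₀ x = (trivializationAt ℂ L x₀).symmₗ ℂ x 1 := by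
    rw [frame, Trivialization.coe_symmₗ (hb := hx)]
  rw [h1, ← map_smul, smul_eq_mul, mul_one, Trivialization.coe_symmₗ (hb := hx)]
  exact (trivializationAt ℂ L x₀).symm_apply_apply_mk hx v

theorem HermitianMetric.inner_self_eq_re (h : HermitianMetric n L) {x : M} (v : L x) :
    h.inner x v v = ((h.inner x v v).re : ℂ) :=
  (Complex.conj_eq_iff_re.1 (h.conj_symm x v v)).symm

theorem HermitianMetric.inner_self_nonneg (h : HermitianMetric n L) {x : M} (v : L x) :
    0 ≤ (h.inner x v v).re := by
  by_cases hv : v = 0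
  · simp [hv]
  · exact (h.positive x v hv).le

theorem HermitianMetric.inner_smul_smul (h : HermitianMetric n L) {x : M} (v : L x) (a b : ℂ) :
    h.inner x (a • v) (b • v) = conj a * b * ((h.inner x v v).re : ℂ) := by
  rw [← h.inner_self_eq_re, (h.inner x).map_smulₛₗ, LinearMap.smul_apply, map_smul, smul_eq_mul,
    smul_eq_mul, mul_assoc]

/-- A weak Cauchy-Schwarz inequality: on a one-dimensional fibre it reduces to |a||b| ≤ |a|² + |b|².
It makes mixed products integrable once the squares are. -/
theorem HermitianMetric.norm_inner_le (h : HermitianMetric n L) {x : M} (v w : L x) :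
    ‖h.inner x v w‖ ≤ (h.inner x v v).re + (h.inner x w w).re := by
  have hc := fun u : L x => coord_smul_frame x (FiberBundle.mem_baseSet_trivializationAt' x) u
  rw [← hc v, ← hc w]
  generalize (trivializationAt ℂ L x ⟨x, v⟩).2 = a
  generalize (trivializationAt ℂ L x ⟨x, w⟩).2 = b
  have hr := h.inner_self_nonneg (frame L x x)
  have hs : ∀ c : ℂ, (h.inner x (c • frame L x x) (c • frame L x x)).re
      = ‖c‖ ^ 2 * (h.inner x (frame L x x) (frame L x x)).re := by
    intro c
    rw [h.inner_smul_smul, ← Complex.normSq_eq_conj_mul_self, ← Complex.ofReal_mul,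
      Complex.ofReal_re, Complex.normSq_eq_norm_sq]
  rw [hs, hs, h.inner_smul_smul, norm_mul, norm_mul, RCLike.norm_conj, Complex.norm_real,
    Real.norm_of_nonneg hr, ← add_mul]
  refine mul_le_mul_of_nonneg_right ?_ hr
  nlinarith [sq_nonneg (‖a‖ - ‖b‖), sq_nonneg (‖a‖ + ‖b‖)]

/-- In a local frame the product is conj(a) b times the squared norm of the frame, with continuous a
and b. This supplies measurability of the integrands. -/
theorem HermitianMetric.continuous_inner (h : HermitianMetric n L) (φ ψ : HolSection n L) :
    Continuous fun x => h.inner x (φ x) (ψ x) := by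
  rw [continuous_iff_continuousAt]
  intro x₀
  have hmem := FiberBundle.mem_baseSet_trivializationAt' (F := ℂ) (E := L) x₀
  have hnhds := (trivializationAt ℂ L x₀).open_baseSet.mem_nhds hmem
  have hcoord : ∀ χ : HolSection n L,
      ContinuousAt (fun x => (trivializationAt ℂ L x₀ ⟨x, χ x⟩).2) x₀ := by
    intro χ
    have h1 : ContinuousAt (fun x => (⟨x, χ x⟩ : TotalSpace ℂ L)) x₀ :=
      χ.contMDiff.continuous.continuousAt
    have h2 : ContinuousAt (trivializationAt ℂ L x₀) (⟨x₀, χ x₀⟩ : TotalSpace ℂ L) :=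
      (trivializationAt ℂ L x₀).continuousAt ((trivializationAt ℂ L x₀).mem_source.2 hmem)
    exact continuousAt_snd.comp (ContinuousAt.comp (f := fun x => (⟨x, χ x⟩ : TotalSpace ℂ L)) h2 h1)
  have hmetric : ContinuousAt (fun x => ((h.inner x (frame L x₀ x) (frame L x₀ x)).re : ℂ)) x₀ :=
    Complex.continuous_ofReal.continuousAt.comp ((h.smooth x₀).continuousOn.continuousAt hnhds)
  refine (((Complex.continuous_conj.continuousAt.comp (hcoord φ)).mul (hcoord ψ)).mul
    hmetric).congr ?_
  filter_upwards [hnhds] with x hx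
  simp only [Pi.mul_apply, Function.comp_apply]
  rw [← h.inner_smul_smul, coord_smul_frame x₀ hx, coord_smul_frame x₀ hx]

theorem _root_.ContMDiffSection.sum_apply {ι : Type*} (u : Finset ι) (b : ι → HolSection n L)
    (x : M) : (∑ k ∈ u, b k) x = ∑ k ∈ u, b k x := by
  rw [← ContMDiffSection.coeAddHom_apply, map_sum, Finset.sum_apply]
  rfl

theorem quotient_smul_right {x : M} (q v : L x) (c : ℂ) :
    quotient q (c • v) = c * quotient q v := by
  rw [quotient, fibre_coord_smul, mul_div_assoc, quotient]

theorem quotient_add_right {x : M} (q v w : L x) :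
    quotient q (v + w) = quotient q v + quotient q w := by
  simp only [quotient, ((trivializationAt ℂ L x).linear ℂ
    (FiberBundle.mem_baseSet_trivializationAt' x)).map_add v w, add_div]

theorem qHat_sum {ι : Type*} [Fintype ι] {x : M} (q : L x) (a : ι → ℂ) (b : ι → HolSection n L) :
    qHat q (∑ k, a k • b k : HolSection n L) = ∑ k, a k * qHat q (b k) := by
  let f : L x →ₗ[ℂ] ℂ :=
    { toFun := quotient q
      map_add' := quotient_add_right q
      map_smul' := fun c v => quotient_smul_right q v c }
  change f _ = ∑ k, a k * f (b k x)
  simp only [ContMDiffSection.sum_apply, map_sum, map_smul, ContMDiffSection.coe_smul,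
    Pi.smul_apply, smul_eq_mul]

variable [MeasurableSpace M] [BorelSpace M] {κ : TwoForm n M} {h : HermitianMetric n L}

theorem sectionInner_conj_symm (φ ψ : ∀ x, L x) :
    conj (sectionInner κ h φ ψ) = sectionInner κ h ψ φ := by
  simp only [sectionInner, ← integral_conj, h.conj_symm]

/-- Two sections whose norms are square integrable have an integrable scalar product. -/
theorem integrable_inner_of_self {φ ψ : HolSection n L}
    (hφ : Integrable (fun x => h.inner x (φ x) (φ x)) κ.volumeMeasure)
    (hψ : Integrable (fun x => h.inner x (ψ x) (ψ x)) κ.volumeMeasure) :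
    Integrable (fun x => h.inner x (φ x) (ψ x)) κ.volumeMeasure :=
  (hφ.re.add hψ.re).mono' (h.continuous_inner φ ψ).aestronglyMeasurable
    (Filter.Eventually.of_forall fun _ => h.norm_inner_le _ _)

/-- A finite spanning family of holomorphic sections that is orthogonal, all its members having
the same square norm `c ≠ 0`. -/
structure IsOrthogonalFrame (κ : TwoForm n M) (h : HermitianMetric n L) {ι : Type*}
    [DecidableEq ι] (b : ι → HolSection n L) (c : ℝ) : Prop where
  span : ⊤ ≤ Submodule.span ℂ (Set.range b)
  ne_zero : c ≠ 0
  inner_eq : ∀ j k, sectionInner κ h (b j) (b k) = if j = k then (c : ℂ) else 0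

namespace IsOrthogonalFrame

variable {ι : Type*} [DecidableEq ι] {b : ι → HolSection n L} {c : ℝ}

/-- The Bochner integral of a non-integrable function is 0, so a non-zero square norm already forces
integrability. -/
theorem integrable_self (hb : IsOrthogonalFrame κ h b c) (j : ι) :
    Integrable (fun x => h.inner x (b j x) (b j x)) κ.volumeMeasure := by
  by_contra hj
  have h1 := hb.inner_eq j j
  rw [if_pos rfl, sectionInner, integral_undef hj] at h1
  exact hb.ne_zero (by exact_mod_cast h1.symm)

variable [Fintype ι]

theorem exists_eq_sum (hb : IsOrthogonalFrame κ h b c) (φ : HolSection n L) :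
    ∃ a : ι → ℂ, ∑ j, a j • b j = φ :=
  (Submodule.mem_span_range_iff_exists_fun ℂ).1 (hb.span trivial)

theorem integrable_inner (hb : IsOrthogonalFrame κ h b c) (φ ψ : HolSection n L) :
    Integrable (fun x => h.inner x (φ x) (ψ x)) κ.volumeMeasure := by
  suffices hint : ∀ φ : HolSection n L,
      Integrable (fun x => h.inner x (φ x) (φ x)) κ.volumeMeasure from
    integrable_inner_of_self (hint φ) (hint ψ)
  intro φ
  have hφ : φ ∈ Submodule.span ℂ (Set.range b) := hb.span trivial
  induction hφ using Submodule.span_induction with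
  | mem u hu => obtain ⟨j, rfl⟩ := hu; exact hb.integrable_self j
  | zero => simp
  | add u v _ _ hu hv =>
    have huv := integrable_inner_of_self hu hv
    have hvu := integrable_inner_of_self hv hu
    refine ((hu.add huv).add (hvu.add hv)).congr (Filter.Eventually.of_forall fun x => ?_)
    simp only [ContMDiffSection.coe_add, Pi.add_apply, map_add, LinearMap.add_apply]
    ring
  | smul r u _ hu =>
    refine (hu.const_mul (conj r * r)).congr (Filter.Eventually.of_forall fun x => ?_)
    simp only [ContMDiffSection.coe_smul, Pi.smul_apply, map_smul, (h.inner x).map_smulₛₗ,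
      LinearMap.smul_apply, smul_eq_mul]
    ring

theorem sectionInner_sum_right (hb : IsOrthogonalFrame κ h b c) (φ : HolSection n L) (a : ι → ℂ) :
    sectionInner κ h φ (∑ k, a k • b k : HolSection n L)
      = ∑ k, a k * sectionInner κ h φ (b k) := by
  simp only [sectionInner]
  rw [← integral_congr_ae (Filter.Eventually.of_forall fun x => ?_),
    integral_finsetSum (f := fun k x => a k * h.inner x (φ x) (b k x)) Finset.univ
      fun k _ => (hb.integrable_inner φ (b k)).const_mul _]
  · simp only [integral_const_mul]
  · simp only [ContMDiffSection.sum_apply, map_sum, map_smul, ContMDiffSection.coe_smul,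
      Pi.smul_apply, smul_eq_mul]

theorem sectionInner_sum_left (hb : IsOrthogonalFrame κ h b c) (j : ι) (a : ι → ℂ) :
    sectionInner κ h (∑ k, a k • b k : HolSection n L) (b j) = conj (a j) * c := by
  rw [← sectionInner_conj_symm, hb.sectionInner_sum_right]
  simp only [hb.inner_eq, mul_ite, mul_zero, Finset.sum_ite_eq, Finset.mem_univ, if_true, map_mul,
    Complex.conj_ofReal]

theorem sectionInner_sum_sum (hb : IsOrthogonalFrame κ h b c) (a d : ι → ℂ) :
    sectionInner κ h (∑ k, a k • b k : HolSection n L) (∑ k, d k • b k : HolSection n L)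
      = c * ∑ k, conj (a k) * d k := by
  rw [hb.sectionInner_sum_right, Finset.mul_sum]
  refine Finset.sum_congr rfl fun k _ => ?_
  rw [hb.sectionInner_sum_left]
  ring

/-- The coefficients are conjugated because the scalar product is conjugate linear in its first
argument; pairing with b_k contributes a factor c, which the denominator removes. -/
theorem isCoherentVector (hb : IsOrthogonalFrame κ h b c) {x : M} (q : L x) :
    IsCoherentVector κ h q (∑ j, (conj (qHat q (b j)) / c) • b j : HolSection n L) := by
  intro u
  obtain ⟨a, rfl⟩ := hb.exists_eq_sum u
  have hc : (c : ℂ) ≠ 0 := by exact_mod_cast hb.ne_zero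
  rw [hb.sectionInner_sum_sum, qHat_sum, Finset.mul_sum]
  refine Finset.sum_congr rfl fun k _ => ?_
  rw [map_div₀, Complex.conj_conj, Complex.conj_ofReal]
  field_simp

/-- Pairing with b_k isolates the k-th coefficient, so the defining property determines all of them.
-/
theorem eq_of_isCoherentVector (hb : IsOrthogonalFrame κ h b c) {x : M} {q : L x}
    {e : HolSection n L} (he : IsCoherentVector κ h q e) :
    e = ∑ j, (conj (qHat q (b j)) / c) • b j := by
  obtain ⟨a, rfl⟩ := hb.exists_eq_sum e
  have hc : (c : ℂ) ≠ 0 := by exact_mod_cast hb.ne_zero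
  refine Finset.sum_congr rfl fun k _ => ?_
  congr 1
  have h1 := he (b k)
  rw [hb.sectionInner_sum_left] at h1
  rw [← h1, map_mul, Complex.conj_conj, Complex.conj_ofReal, mul_div_cancel_right₀ _ hc]

theorem existsUnique_isCoherentVector (hb : IsOrthogonalFrame κ h b c) {x : M} (q : L x) :
    ∃! e, IsCoherentVector κ h q e :=
  ⟨_, hb.isCoherentVector q, fun _ he => hb.eq_of_isCoherentVector he⟩

theorem coherentVector_eq (hb : IsOrthogonalFrame κ h b c) {x : M} (q : L x) :
    coherentVector κ h q = ∑ j, (conj (qHat q (b j)) / c) • b j := by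
  have hex : ∃ e, IsCoherentVector κ h q e := ⟨_, hb.isCoherentVector q⟩
  rw [coherentVector, dif_pos hex]
  exact hb.eq_of_isCoherentVector hex.choose_spec

/-- Each coherent vector carries c⁻¹ and the square norms carry c, which leaves one c⁻¹. -/
theorem coherentInner_eq (hb : IsOrthogonalFrame κ h b c) (t : ∀ x, L x) (x y : M) :
    coherentInner κ h t x y = (∑ j, qHat (t x) (b j) * conj (qHat (t y) (b j))) / c := by
  have hc : (c : ℂ) ≠ 0 := by exact_mod_cast hb.ne_zero
  rw [coherentInner, hb.coherentVector_eq, hb.coherentVector_eq, hb.sectionInner_sum_sum,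
    Finset.mul_sum, Finset.sum_div]
  refine Finset.sum_congr rfl fun j _ => ?_
  rw [map_div₀, Complex.conj_conj, Complex.conj_ofReal]
  field_simp

end IsOrthogonalFrame

end CoherentVectors

end CoherentStates

/-! ### Holomorphic sections of the hyperplane bundle are linear forms -/

namespace CoherentStates

/-- Entire functions of at most linear growth are affine. -/
theorem eq_add_deriv_mul_of_linear_growth {g : ℂ → ℂ} (hg : Differentiable ℂ g) {A : ℝ}
    (hA : ∀ z, ‖g z‖ ≤ A * (1 + ‖z‖)) (z : ℂ) : g z = g 0 + deriv g 0 * z := by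
  have hA0 : 0 ≤ A := by simpa using (norm_nonneg _).trans (hA 0)
  have hbound : ∀ c, ‖deriv g c‖ ≤ 2 * A := by
    intro c
    have hR : 0 < 1 + ‖c‖ := by positivity
    -- Cauchy's estimate with radius 1 + ‖c‖: on that circle 1 + ‖w‖ ≤ 2 (1 + ‖c‖), so the bound 2A
    -- does not depend on the centre.
    have h1 := Complex.norm_deriv_le_of_forall_mem_sphere_norm_le (C := A * (2 * (1 + ‖c‖))) hR
      hg.diffContOnCl fun w hw => (hA w).trans (by
        have h2 : ‖w‖ ≤ ‖c‖ + (1 + ‖c‖) := by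
          rw [mem_sphere_iff_norm] at hw
          calc ‖w‖ = ‖c + (w - c)‖ := by ring_nf
            _ ≤ ‖c‖ + ‖w - c‖ := norm_add_le _ _
            _ = _ := by rw [hw]
        gcongr
        linarith)
    refine h1.trans_eq ?_
    field_simp
  have hderiv : Differentiable ℂ (deriv g) := (hg.contDiff (n := 2)).differentiable_deriv_two
  -- Liouville's theorem for the derivative.
  have hconst : ∀ c, deriv g c = deriv g 0 := fun c =>
    hderiv.apply_eq_apply_of_bounded
      (isBounded_iff_forall_norm_le.2 ⟨2 * A, by rintro _ ⟨c, rfl⟩; exact hbound c⟩) c 0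
  have h3 : ∀ w, HasDerivAt (fun w => g w - deriv g 0 * w) 0 w := fun w => by
    have := (hg w).hasDerivAt.sub ((hasDerivAt_id w).const_mul (deriv g 0))
    rw [hconst w, mul_one, sub_self] at this
    exact this
  have h4 := is_const_of_deriv_eq_zero (fun w => (h3 w).differentiableAt) (fun w => (h3 w).deriv) z 0
  simp only [mul_zero, sub_zero] at h4
  rw [← h4]
  ring

/-- Holomorphic functions on `ℂ^N` of at most linear growth are affine. -/
theorem eq_add_fderiv_of_linear_growth {E : Type*} [NormedAddCommGroup E] [NormedSpace ℂ E]
    {F : E → ℂ} (hF : Differentiable ℂ F) {A : ℝ} (hA : ∀ w, ‖F w‖ ≤ A * (1 + ‖w‖)) (w : E) :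
    F w = F 0 + fderiv ℂ F 0 w := by
  have hA0 : 0 ≤ A := by simpa using (norm_nonneg _).trans (hA 0)
  have h1 : ∀ z : ℂ, HasDerivAt (fun z : ℂ => F (z • w)) (fderiv ℂ F (z • w) w) z := fun z => by
    have h2 : HasDerivAt (fun z : ℂ => z • w) w z := by
      simpa using (hasDerivAt_id z).smul_const w
    exact (hF (z • w)).hasFDerivAt.comp_hasDerivAt z h2
  -- Restrict to the complex line through 0 and w, where the growth constant becomes A (1 + ‖w‖),
  -- and evaluate at z = 1.
  have h3 := eq_add_deriv_mul_of_linear_growth (g := fun z : ℂ => F (z • w))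
    (fun z => (h1 z).differentiableAt) (A := A * (1 + ‖w‖)) (fun z => by
      refine (hA _).trans ?_
      rw [norm_smul, mul_assoc]
      refine mul_le_mul_of_nonneg_left ?_ hA0
      nlinarith [norm_nonneg w, norm_nonneg z]) 1
  rw [(h1 0).deriv] at h3
  simpa using h3

namespace CP

variable {N : ℕ}

theorem mk_smul (z : Fin (N + 1) → ℂ) (hz : z ≠ 0) (c : ℂ) (hc : c • z ≠ 0) :
    mk (c • z) hc = mk z hz :=
  (mk_eq_mk_iff _ _ _ _).2 ⟨c, rfl⟩

/-- The coordinate of a vector of the hyperplane bundle in the frame `Z_k`. -/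
theorem localTriv_apply_snd (k : Fin (N + 1)) (p : CP N) (v : H N p) :
    ((hyperplaneCore N).localTriv k ⟨p, v⟩).2 = ratio p.index k p * (show ℂ from v) := by
  rw [VectorBundleCore.localTriv_apply]
  rfl

theorem pairing_eq_localTriv_mul {k : Fin (N + 1)} {z : Fin (N + 1) → ℂ} (hz : z ≠ 0)
    (hk : z k ≠ 0) (v : H N (mk z hz)) :
    pairing v z = ((hyperplaneCore N).localTriv k ⟨mk z hz, v⟩).2 * z k := by
  rw [localTriv_apply_snd, ratio_mk, pairing]
  field_simp

instance (k : Fin (N + 1)) : MemTrivializationAtlas ((hyperplaneCore N).localTriv k) :=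
  ⟨⟨k, rfl⟩⟩

/-- The affine charts cover ℙ^N, so holomorphy can be tested on the coefficients in the frames Z_k.
-/
theorem contMDiff_iff_localTriv {m : WithTop ℕ∞}
    [ContMDiffVectorBundle m ℂ (H N) 𝓘(ℂ, Fin N → ℂ)] (t : ∀ p, H N p) :
    ContMDiff 𝓘(ℂ, Fin N → ℂ) (𝓘(ℂ, Fin N → ℂ).prod 𝓘(ℂ, ℂ)) m
      (fun p => (⟨p, t p⟩ : TotalSpace ℂ (H N))) ↔
    ∀ k, ContMDiffOn 𝓘(ℂ, Fin N → ℂ) 𝓘(ℂ, ℂ) m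
      (fun p => ((hyperplaneCore N).localTriv k ⟨p, t p⟩).2) (affine k) := by
  constructor
  · intro h k
    exact ((hyperplaneCore N).localTriv k).contMDiffOn_section_baseSet_iff.1 h.contMDiffOn
  · intro h p
    have h1 := ((hyperplaneCore N).localTriv p.index).contMDiffOn_section_baseSet_iff
      (IB := 𝓘(ℂ, Fin N → ℂ)) (n := m) (s := t)
    exact (h1.2 (h p.index)).contMDiffAt ((isOpen_affine p.index).mem_nhds (mem_affine_index p))

/-- The linear form `Z_j`, as a holomorphic section of the hyperplane bundle. -/
noncomputable def coordHolSection (j : Fin (N + 1)) : HolSection N (H N) where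
  toFun := coordSection j
  contMDiff_toFun := by
    refine (contMDiff_iff_localTriv _).2 fun k => (contMDiffOn_ratio ℂ ω j k).congr fun p hp => ?_
    have hi : p.rep p.index ≠ 0 := mem_affine_index p
    rw [localTriv_apply_snd]
    change ratio p.index k p * ratio j p.index p = ratio j k p
    simp only [ratio]
    field_simp

/-- The homogeneous function on `ℂ^{N+1} ∖ {0}` defined by a section of the hyperplane bundle. -/
noncomputable def homogeneousFun (t : ∀ p, H N p) (z : {z : Fin (N + 1) → ℂ // z ≠ 0}) : ℂ :=
  pairing (t (mk z.1 z.2)) z.1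

theorem homogeneousFun_smul (t : ∀ p, H N p) (z : Fin (N + 1) → ℂ) (hz : z ≠ 0) (c : ℂ)
    (hc : c • z ≠ 0) : homogeneousFun t ⟨c • z, hc⟩ = c * homogeneousFun t ⟨z, hz⟩ := by
  simp only [homogeneousFun, pairing]
  rw [mk_smul z hz c hc, Pi.smul_apply, smul_eq_mul]
  exact mul_left_comm (G := ℂ) _ _ _

theorem continuous_homogeneousFun (t : HolSection N (H N)) : Continuous (homogeneousFun t) := by
  rw [continuous_iff_continuousAt]
  intro z
  obtain ⟨k, hk⟩ := Function.ne_iff.1 z.2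
  have hc : ∀ l, Continuous fun z : {z : Fin (N + 1) → ℂ // z ≠ 0} => z.1 l :=
    fun l => (continuous_apply l).comp continuous_subtype_val
  have hopen : {z : {z : Fin (N + 1) → ℂ // z ≠ 0} | z.1 k ≠ 0} ∈ 𝓝 z :=
    (isOpen_ne_fun (hc k) continuous_const).mem_nhds hk
  have h1 := ((contMDiff_iff_localTriv _).1 t.contMDiff k).continuousOn.continuousAt
    ((isOpen_affine k).mem_nhds ((mk_mem_affine k z.1 z.2).2 hk))
  have h2 : ContinuousAt (fun z : {z : Fin (N + 1) → ℂ // z ≠ 0} => mk z.1 z.2) z :=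
    isQuotientMap_mk.continuous.continuousAt
  refine ((ContinuousAt.comp (f := fun z : {z : Fin (N + 1) → ℂ // z ≠ 0} => mk z.1 z.2) h1 h2).mul
    (hc k).continuousAt).congr ?_
  filter_upwards [hopen] with y hy
  exact (pairing_eq_localTriv_mul y.2 hy _).symm

theorem exists_norm_homogeneousFun_le (t : HolSection N (H N)) :
    ∃ C : ℝ, 0 ≤ C ∧ ∀ z, ‖homogeneousFun t z‖ ≤ C * ‖z.1‖ := by
  -- The unit sphere avoids the origin, so it stays compact in the punctured space.
  have hS : IsCompact {z : {z : Fin (N + 1) → ℂ // z ≠ 0} | ‖z.1‖ = 1} := by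
    rw [Subtype.isCompact_iff]
    convert! isCompact_sphere (0 : Fin (N + 1) → ℂ) 1 using 1
    ext z
    simp only [Set.mem_image, Set.mem_ofPred_eq, Subtype.exists, mem_sphere_zero_iff_norm]
    constructor
    · rintro ⟨y, _, hy, rfl⟩
      exact hy
    · intro hz
      exact ⟨z, fun h0 => by simp [h0] at hz, hz, rfl⟩
  obtain ⟨C, hC⟩ := hS.exists_bound_of_continuousOn (continuous_homogeneousFun t).continuousOn
  refine ⟨max C 0, le_max_right _ _, fun z => ?_⟩
  have hz : ‖z.1‖ ≠ 0 := norm_ne_zero_iff.2 z.2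
  -- Normalise z to the sphere and return by homogeneity of degree one.
  have hc : ((‖z.1‖⁻¹ : ℝ) : ℂ) • z.1 ≠ 0 := smul_ne_zero (by simpa using z.2) z.2
  have h1 := hC ⟨_, hc⟩ (by
    simp only [Set.mem_ofPred_eq, norm_smul, Complex.norm_real, norm_inv, norm_norm]
    exact inv_mul_cancel₀ hz)
  rw [homogeneousFun_smul t z.1 z.2, norm_mul, Complex.norm_real, norm_inv, norm_norm] at h1
  calc ‖homogeneousFun t z‖ = (‖z.1‖⁻¹ * ‖homogeneousFun t z‖) * ‖z.1‖ := by field_simp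
    _ ≤ max C 0 * ‖z.1‖ := by
      gcongr
      exact h1.trans (le_max_left _ _)

theorem norm_lift_le (k : Fin (N + 1)) (w : Fin N → ℂ) : ‖lift k w‖ ≤ 1 + ‖w‖ := by
  refine (pi_norm_le_iff_of_nonneg (by positivity)).2 fun i => ?_
  rcases Fin.eq_self_or_eq_succAbove k i with rfl | ⟨j, rfl⟩
  · simp [lift_self]
  · rw [lift_succAbove]
    linarith [norm_le_pi_norm w j]

/-- On `lift k w` the frame Z_k takes the value 1, so the function is the coefficient of t in this
frame, read in the k-th chart. -/
theorem differentiable_homogeneousFun_lift (t : HolSection N (H N)) (k : Fin (N + 1)) :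
    Differentiable ℂ fun w => homogeneousFun t ⟨lift k w, lift_ne_zero k w⟩ := by
  have h1 := (contMDiff_iff_localTriv _).1 t.contMDiff k
  have h2 : ContMDiffOn 𝓘(ℂ, Fin N → ℂ) 𝓘(ℂ, Fin N → ℂ) ω (chart k).symm Set.univ :=
    contMDiffOn_symm_of_mem_maximalAtlas (IsManifold.subset_maximalAtlas ⟨k, rfl⟩)
  have h3 := h1.comp h2 fun w _ => (chart k).map_target (Set.mem_univ w)
  have h4 := (contMDiffOn_univ.1 h3).contDiff.differentiable (by simp)
  refine (congrArg (Differentiable ℂ) (funext fun w => ?_)).mpr h4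
  refine (pairing_eq_localTriv_mul (k := k) (lift_ne_zero k w) (by simp [lift_self]) _).trans ?_
  rw [lift_self, mul_one]
  rfl

theorem lift_div (k : Fin (N + 1)) (z : Fin (N + 1) → ℂ) (hk : z k ≠ 0) :
    z k • lift k (fun j => z (k.succAbove j) / z k) = z := by
  ext i
  rcases Fin.eq_self_or_eq_succAbove k i with rfl | ⟨j, rfl⟩
  · simp [lift_self]
  · simp [lift_succAbove, mul_div_cancel₀ _ hk]

/-- Evaluation at a coordinate is an open map, so preimages of dense sets are dense. An identity
checked on one affine chart thus extends by continuity. -/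
theorem dense_coord_ne_zero (k : Fin (N + 1)) :
    Dense {z : {z : Fin (N + 1) → ℂ // z ≠ 0} | z.1 k ≠ 0} := by
  have h1 : Dense {z : Fin (N + 1) → ℂ | z k ≠ 0} :=
    (dense_compl_singleton (0 : ℂ)).preimage (isOpenMap_eval k)
  exact h1.preimage (isOpen_ne.isOpenMap_subtype_val)

/-- The function on `ℂ^{N+1} ∖ {0}` defined by a holomorphic section of the hyperplane bundle is a
linear form. -/
theorem exists_homogeneousFun_eq_sum (t : HolSection N (H N)) :
    ∃ a : Fin (N + 1) → ℂ, ∀ z, homogeneousFun t z = ∑ j, a j * z.1 j := by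
  obtain ⟨C, hC0, hC⟩ := exists_norm_homogeneousFun_le t
  set F : (Fin N → ℂ) → ℂ := fun w => homogeneousFun t ⟨lift 0 w, lift_ne_zero 0 w⟩
  have hF : ∀ w, F w = F 0 + fderiv ℂ F 0 w :=
    eq_add_fderiv_of_linear_growth (differentiable_homogeneousFun_lift t 0) (A := C) fun w =>
      (hC _).trans (mul_le_mul_of_nonneg_left (norm_lift_le 0 w) hC0)
  -- Homogenising the affine function F(0) + F'(0)w: its constant term becomes the coefficient of
  -- z_0, its partial derivatives the other ones.
  refine ⟨Fin.cons (F 0) fun j => fderiv ℂ F 0 (Pi.single j 1), fun z => ?_⟩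
  refine congrFun (Continuous.ext_on (dense_coord_ne_zero 0) (continuous_homogeneousFun t)
    (g := fun z : {z : Fin (N + 1) → ℂ // z ≠ 0} => ∑ j, (Fin.cons (F 0) fun j =>
      fderiv ℂ F 0 (Pi.single j 1) : Fin (N + 1) → ℂ) j * z.1 j)
    (continuous_finsetSum _ fun j _ => continuous_const.mul ((continuous_apply j).comp continuous_subtype_val)) fun z hz => ?_) z
  have hz0 : z.1 0 ≠ 0 := hz
  set w : Fin N → ℂ := fun j => z.1 (Fin.succAbove 0 j) / z.1 0
  have hzw : z.1 0 • lift 0 w = z.1 := lift_div 0 z.1 hz0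
  have h1 : homogeneousFun t z = z.1 0 * F w := by
    have h2 := homogeneousFun_smul t (lift 0 w) (lift_ne_zero 0 w) (z.1 0)
      (by rw [hzw]; exact z.2)
    rw [← h2]
    congr 1
    exact Subtype.ext hzw.symm
  have h3 : fderiv ℂ F 0 w = ∑ j, w j * fderiv ℂ F 0 (Pi.single j 1) := by
    conv_lhs => rw [pi_eq_sum_univ' w]
    simp [map_sum]
  beta_reduce
  rw [h1, hF w, h3, Fin.sum_univ_succ]
  simp only [Fin.cons_zero, Fin.cons_succ, mul_add, Finset.mul_sum]
  congr 1
  · ring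
  · refine Finset.sum_congr rfl fun j _ => ?_
    simp only [w, Fin.zero_succAbove]
    field_simp

/-- Two vectors of the fibre at p agree once they agree as linear forms on the representative
`p.rep`, whose coordinate at `p.index` is non-zero. -/
theorem span_coordHolSection :
    ⊤ ≤ Submodule.span ℂ (Set.range (coordHolSection (N := N))) := by
  intro t _
  obtain ⟨a, ha⟩ := exists_homogeneousFun_eq_sum t
  rw [Submodule.mem_span_range_iff_exists_fun]
  refine ⟨a, ContMDiffSection.ext fun p => ?_⟩
  have hi : p.rep p.index ≠ 0 := mem_affine_index p
  have h1 := ha ⟨p.rep, p.rep_ne_zero⟩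
  rw [homogeneousFun, pairing, p.mk_rep] at h1
  rw [ContMDiffSection.sum_apply]
  have h2 : ∀ v w : ℂ, v * p.rep p.index = w * p.rep p.index → v = w :=
    fun v w => mul_right_cancel₀ hi
  refine h2 _ _ (Eq.trans ?_ h1.symm)
  change (∑ j, a j * ratio j p.index p : ℂ) * p.rep p.index = _
  rw [Finset.sum_mul]
  refine Finset.sum_congr rfl fun j _ => ?_
  simp only [ratio]
  field_simp

end CP

end CoherentStates

/-! ### The Fubini-Study form in the affine charts and its determinant -/

namespace CoherentStates.CP

variable {N : ℕ}

/-- The derivative of `lift k`: the vector with `k`-th entry `0` and remaining entries `u`. -/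
noncomputable def tangentLift (k : Fin (N + 1)) (u : Fin N → ℂ) : Fin (N + 1) → ℂ :=
  k.insertNth (α := fun _ => ℂ) 0 u

theorem tangentLift_self (k : Fin (N + 1)) (u : Fin N → ℂ) : tangentLift k u k = 0 := by
  simp [tangentLift]

theorem tangentLift_succAbove (k : Fin (N + 1)) (u : Fin N → ℂ) (j : Fin N) :
    tangentLift k u (k.succAbove j) = u j := by simp [tangentLift]

theorem lift_add_smul (k : Fin (N + 1)) (w u : Fin N → ℂ) (r : ℝ) (i : Fin (N + 1)) :
    lift k (w + r • u) i = lift k w i + r * tangentLift k u i := by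
  rcases Fin.eq_self_or_eq_succAbove k i with rfl | ⟨j, rfl⟩
  · simp [lift_self, tangentLift_self]
  · simp [lift_succAbove, tangentLift_succAbove]

/-- The Fubini-Study hermitian form on `ℂ^{N+1} ∖ {0}`, in homogeneous coordinates. -/
noncomputable def homogeneousHermitian (z u v : Fin (N + 1) → ℂ) : ℂ :=
  ((∑ i, z i * conj (z i)) * (∑ i, u i * conj (v i)) -
    (∑ i, u i * conj (z i)) * ∑ i, z i * conj (v i)) / (∑ i, z i * conj (z i)) ^ 2

theorem sum_mul_conj_self {ι : Type*} [Fintype ι] (z : ι → ℂ) :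
    ∑ i, z i * conj (z i) = ((∑ i, ‖z i‖ ^ 2 : ℝ) : ℂ) := by
  simp [Complex.mul_conj, Complex.normSq_eq_norm_sq]

theorem sum_norm_sq_lift (k : Fin (N + 1)) (w : Fin N → ℂ) :
    ∑ i, ‖lift k w i‖ ^ 2 = 1 + ∑ j, ‖w j‖ ^ 2 := by
  simp [Fin.sum_univ_succAbove _ k, lift_self, lift_succAbove]

theorem fsHermitian_eq_homogeneousHermitian (k : Fin (N + 1)) (w u v : Fin N → ℂ) :
    fsHermitian w u v = homogeneousHermitian (lift k w) (tangentLift k u) (tangentLift k v) := by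
  rw [homogeneousHermitian, sum_mul_conj_self, sum_norm_sq_lift, fsHermitian]
  simp only [Fin.sum_univ_succAbove _ k, lift_self, lift_succAbove, tangentLift_self,
    tangentLift_succAbove, map_zero, mul_zero, zero_mul, zero_add]
  simp only [mul_comm (conj _) (_ : ℂ)]

/-- The numerator is a Gram-type determinant, insensitive to adding multiples of z to u or v.
Scaling multiplies numerator and denominator by |r|⁴. Hence the form descends to ℙ^N. -/
theorem homogeneousHermitian_rescale {z : Fin (N + 1) → ℂ} (hz : z ≠ 0) (u v : Fin (N + 1) → ℂ)
    {r : ℂ} (hr : r ≠ 0) (a b : ℂ) :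
    homogeneousHermitian (r • z) (r • u + a • z) (r • v + b • z) = homogeneousHermitian z u v := by
  have hS : (∑ i, z i * conj (z i)) ≠ 0 := by
    rw [sum_mul_conj_self]
    obtain ⟨i, hi⟩ := Function.ne_iff.1 hz
    have : 0 < ∑ i, ‖z i‖ ^ 2 :=
      Finset.sum_pos' (fun i _ => by positivity) ⟨i, Finset.mem_univ i, by
        have : z i ≠ 0 := hi
        positivity⟩
    exact_mod_cast this.ne'
  have hr' : conj r ≠ 0 := by simpa using hr
  have h1 : ∀ (c d : ℂ) (x y : Fin (N + 1) → ℂ),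
      ∑ i, c * x i * (d * y i) = c * d * ∑ i, x i * y i := fun c d x y => by
    rw [Finset.mul_sum]
    exact Finset.sum_congr rfl fun i _ => by ring
  simp only [homogeneousHermitian, Pi.add_apply, Pi.smul_apply, smul_eq_mul, map_add, map_mul,
    mul_add, add_mul, Finset.sum_add_distrib, h1]
  generalize (∑ i, z i * conj (z i)) = S at *
  generalize (∑ i, u i * conj (v i)) = A
  generalize (∑ i, u i * conj (z i)) = B
  generalize (∑ i, z i * conj (v i)) = C
  field_simp
  ring

/-- The transition map has components `lift k w i / lift k w l`, so this is the quotient rule along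
the real line w + ru. -/
theorem lineDeriv_chart_chart_symm (k l : Fin (N + 1)) {w : Fin N → ℂ} (hw : lift k w l ≠ 0)
    (u : Fin N → ℂ) :
    HasLineDerivAt ℝ (fun y => chart l ((chart k).symm y))
      (fun j => (tangentLift k u (l.succAbove j) * lift k w l -
        lift k w (l.succAbove j) * tangentLift k u l) / lift k w l ^ 2) w u := by
  refine hasDerivAt_pi.2 fun j => ?_
  have h1 : ∀ i, HasDerivAt (fun r : ℝ => lift k (w + r • u) i) (tangentLift k u i) 0 := fun i => by
    simp only [lift_add_smul]
    have := ((Complex.ofRealCLM.hasDerivAt (x := (0 : ℝ))).mul_const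
      (tangentLift k u i)).const_add (lift k w i)
    simpa using this
  have h2 := (h1 (l.succAbove j)).div (h1 l) (by simpa using hw)
  simp only [zero_smul, add_zero] at h2
  refine h2.congr_of_eventuallyEq (Filter.Eventually.of_forall fun r => ?_)
  exact ratio_mk _ _ _ _

theorem lift_chart_chart_symm (k l : Fin (N + 1)) {w : Fin N → ℂ} (hw : lift k w l ≠ 0) :
    lift l (chart l ((chart k).symm w)) = (lift k w l)⁻¹ • lift k w := by
  have h1 : ∀ j, chart l ((chart k).symm w) j = lift k w (l.succAbove j) / lift k w l :=
    fun j => ratio_mk _ _ _ _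
  ext i
  rcases Fin.eq_self_or_eq_succAbove l i with rfl | ⟨j, rfl⟩
  · simp [lift_self, hw]
  · rw [lift_succAbove, h1, Pi.smul_apply, smul_eq_mul, div_eq_inv_mul]

theorem differentiableAt_chart_chart_symm (k l : Fin (N + 1)) {w : Fin N → ℂ}
    (hw : lift k w l ≠ 0) : DifferentiableAt ℝ (fun y => chart l ((chart k).symm y)) w := by
  refine differentiableAt_pi.2 fun j => ?_
  have h1 := (contDiffOn_ratio ℝ 1 k (l.succAbove j) l).contDiffAt
    ((isOpen_ne_fun (contDiff_lift ℝ 0 k l).continuous continuous_const).mem_nhds hw)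
  exact h1.differentiableAt one_ne_zero

/-- This puts the derivative of a change of charts into the shape r u + a z of
`homogeneousHermitian_rescale`, with r the factor of `lift_chart_chart_symm`. -/
theorem tangentLift_fderiv_chart_chart_symm (k l : Fin (N + 1)) {w : Fin N → ℂ}
    (hw : lift k w l ≠ 0) (u : Fin N → ℂ) :
    tangentLift l (fderiv ℝ (fun y => chart l ((chart k).symm y)) w u) =
      (lift k w l)⁻¹ • tangentLift k u + (-(tangentLift k u l) / lift k w l ^ 2) • lift k w := by
  have h1 := ((differentiableAt_chart_chart_symm k l hw).hasFDerivAt.hasLineDerivAt u).unique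
    (lineDeriv_chart_chart_symm k l hw u)
  rw [h1]
  ext i
  rcases Fin.eq_self_or_eq_succAbove l i with rfl | ⟨j, rfl⟩
  · simp only [tangentLift_self, Pi.add_apply, Pi.smul_apply, smul_eq_mul]
    field_simp
    ring
  · simp only [tangentLift_succAbove, Pi.add_apply, Pi.smul_apply, smul_eq_mul]
    field_simp
    ring

/-- The Fubini-Study form is invariant under the change of affine charts. -/
theorem fsHermitian_chart_chart_symm (k l : Fin (N + 1)) {w : Fin N → ℂ}
    (hw : lift k w l ≠ 0) (u v : Fin N → ℂ) :
    fsHermitian (chart l ((chart k).symm w)) (fderiv ℝ (fun y => chart l ((chart k).symm y)) w u)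
      (fderiv ℝ (fun y => chart l ((chart k).symm y)) w v) = fsHermitian w u v := by
  rw [fsHermitian_eq_homogeneousHermitian l, fsHermitian_eq_homogeneousHermitian k,
    lift_chart_chart_symm k l hw, tangentLift_fderiv_chart_chart_symm k l hw,
    tangentLift_fderiv_chart_chart_symm k l hw,
    homogeneousHermitian_rescale (lift_ne_zero k w) _ _ (inv_ne_zero hw)]

theorem mfderiv_chart_symm (k : Fin (N + 1)) (w : Fin N → ℂ) :
    mfderiv 𝓘(ℝ, Fin N → ℂ) 𝓘(ℝ, Fin N → ℂ) (chart k).symm w =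
      fderiv ℝ (fun y => chart ((chart k).symm w).index ((chart k).symm y)) w := by
  have := isManifold (N := N) ℝ 1
  have h1 : ContMDiffOn 𝓘(ℝ, Fin N → ℂ) 𝓘(ℝ, Fin N → ℂ) 1 (chart (N := N) k).symm Set.univ :=
    contMDiffOn_symm_of_mem_maximalAtlas (IsManifold.subset_maximalAtlas ⟨k, rfl⟩)
  have h2 : MDifferentiableAt 𝓘(ℝ, Fin N → ℂ) 𝓘(ℝ, Fin N → ℂ) (chart (N := N) k).symm w :=
    (contMDiffOn_univ.1 h1 w).mdifferentiableAt one_ne_zero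
  refine h2.mfderiv.trans ?_
  change fderivWithin ℝ (fun y => chart ((chart k).symm w).index ((chart k).symm y))
    (Set.range id) w = _
  rw [Set.range_id, fderivWithin_univ]

/-- Both `fubiniStudy` and `mfderiv` refer to the preferred chart at the image point, so the claim
is invariance under the change from chart k to that chart. -/
theorem inChart_fubiniStudy (k : Fin (N + 1)) (w u v : Fin N → ℂ) :
    (fubiniStudy N).inChart (chart k) w u v = fsForm w u v := by
  have hw : lift k w ((chart k).symm w).index ≠ 0 :=
    (mk_mem_affine _ _ (lift_ne_zero k w)).1 (mem_affine_index _)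
  rw [TwoForm.inChart, mfderiv_chart_symm]
  exact congrArg₂ (fun a b : ℂ => (Complex.I * (a - b)).re)
    (fsHermitian_chart_chart_symm k _ hw u v) (fsHermitian_chart_chart_symm k _ hw v u)

theorem conj_fsHermitian (w u v : Fin N → ℂ) :
    conj (fsHermitian w u v) = fsHermitian w v u := by
  simp only [fsHermitian, map_div₀, map_sub, map_mul, map_sum, map_pow, Complex.conj_conj,
    Complex.conj_ofReal]
  congr 2
  · simp only [mul_comm (conj (u _))]
  · rw [mul_comm]

theorem fsHermitian_smul_right (w u v : Fin N → ℂ) (c : ℂ) :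
    fsHermitian w u (c • v) = conj c * fsHermitian w u v := by
  simp only [fsHermitian, Pi.smul_apply, smul_eq_mul, map_mul, mul_left_comm _ (conj c),
    ← Finset.mul_sum]
  ring

/-- With g the hermitian form, ω(u, v) = -2 Im g(u, v) and ω(u, iv) = 2 Re g(u, v), and the
definition of `coeffMatrix` reassembles g. -/
theorem coeffMatrix_fubiniStudy (k : Fin (N + 1)) (w : Fin N → ℂ) :
    (fubiniStudy N).coeffMatrix (chart k) w =
      Matrix.of fun i j => fsHermitian w (Pi.single i 1) (Pi.single j 1) := by
  have h1 : ∀ u v : Fin N → ℂ, fsForm w u v = -2 * (fsHermitian w u v).im := fun u v => by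
    change (Complex.I * (fsHermitian w u v - fsHermitian w v u)).re = _
    rw [← conj_fsHermitian w u v]
    simp
    ring
  ext i j
  simp only [TwoForm.coeffMatrix, Matrix.of_apply, inChart_fubiniStudy, h1,
    fsHermitian_smul_right]
  apply Complex.ext <;> simp

theorem fsHermitian_single (w : Fin N → ℂ) (i j : Fin N) :
    fsHermitian w (Pi.single i 1) (Pi.single j 1) =
      ((1 + ∑ i, ‖w i‖ ^ 2 : ℝ) : ℂ)⁻¹ * ((1 : Matrix (Fin N) (Fin N) ℂ) i j -
        (((1 + ∑ i, ‖w i‖ ^ 2 : ℝ) : ℂ)⁻¹ * conj (w i)) * w j) := by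
  have hS : ((1 + ∑ i, ‖w i‖ ^ 2 : ℝ) : ℂ) ≠ 0 := by
    exact_mod_cast (by positivity : (0 : ℝ) < 1 + ∑ i, ‖w i‖ ^ 2).ne'
  rw [fsHermitian]
  generalize ((1 + ∑ i, ‖w i‖ ^ 2 : ℝ) : ℂ) = S at *
  have h1 : ∑ l, (Pi.single i 1 : Fin N → ℂ) l * conj ((Pi.single j 1 : Fin N → ℂ) l) =
      (1 : Matrix (Fin N) (Fin N) ℂ) i j := by
    simp [Pi.single_apply, Matrix.one_apply, eq_comm]
  have h2 : ∑ l, conj (w l) * (Pi.single i 1 : Fin N → ℂ) l = conj (w i) := by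
    simp [Pi.single_apply]
  have h3 : ∑ l, w l * conj ((Pi.single j 1 : Fin N → ℂ) l) = w j := by
    simp [Pi.single_apply]
  rw [h1, h2, h3]
  field_simp

/-- With S = 1 + ‖w‖², the matrix is S⁻¹ times a rank-one perturbation of the identity. The matrix
determinant lemma gives S⁻ᴺ (1 - S⁻¹(S - 1)) = S⁻ᴺ⁻¹. -/
theorem det_coeffMatrix_fubiniStudy (k : Fin (N + 1)) (w : Fin N → ℂ) :
    ((fubiniStudy N).coeffMatrix (chart k) w).det =
      (((1 + ∑ i, ‖w i‖ ^ 2)⁻¹ ^ (N + 1) : ℝ) : ℂ) := by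
  set S : ℝ := 1 + ∑ i, ‖w i‖ ^ 2 with hSdef
  have hS : (S : ℂ) ≠ 0 := by
    exact_mod_cast (by positivity : (0 : ℝ) < 1 + ∑ i, ‖w i‖ ^ 2).ne'
  have h1 : (fubiniStudy N).coeffMatrix (chart k) w = (S : ℂ)⁻¹ • (1 +
      Matrix.replicateCol Unit (fun i => -(S : ℂ)⁻¹ * conj (w i)) *
        Matrix.replicateRow Unit w) := by
    rw [coeffMatrix_fubiniStudy]
    ext i j
    simp only [Matrix.of_apply, fsHermitian_single, Matrix.smul_apply, Matrix.add_apply,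
      Matrix.mul_apply, Matrix.replicateCol_apply, Matrix.replicateRow_apply, smul_eq_mul,
      Finset.univ_unique, Finset.sum_singleton, ← hSdef]
    ring
  have h2 : w ⬝ᵥ (fun i => -(S : ℂ)⁻¹ * conj (w i)) = -(S : ℂ)⁻¹ * (S - 1) := by
    have h3 : (S : ℂ) - 1 = ∑ i, w i * conj (w i) := by
      rw [sum_mul_conj_self, hSdef]
      push_cast
      ring
    rw [h3, Finset.mul_sum]
    exact Finset.sum_congr rfl fun i _ => by ring
  rw [h1, Matrix.det_smul, Matrix.det_one_add_replicateCol_mul_replicateRow, h2, Fintype.card_fin]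
  push_cast
  rw [pow_succ]
  field_simp
  ring

end CoherentStates.CP

/-! ### The Fubini-Study volume as image of the Gaussian measure -/

namespace CoherentStates

open scoped ENNReal

/-- The real determinant of a complex linear map is the squared modulus of its complex determinant,
here |cᵈ|² with d the complex dimension. -/
theorem lintegral_eq_mul_lintegral_comp_smul {E : Type*} [NormedAddCommGroup E] [NormedSpace ℂ E]
    [NormedSpace ℝ E] [IsScalarTower ℝ ℂ E] [FiniteDimensional ℂ E] [FiniteDimensional ℝ E]
    [MeasurableSpace E] [BorelSpace E] (μ : Measure E) [μ.IsAddHaarMeasure] {c : ℂ} (hc : c ≠ 0)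
    {g : E → ℝ≥0∞} (hg : Measurable g) :
    ∫⁻ u, g u ∂μ = ENNReal.ofReal (‖c‖ ^ (2 * Module.finrank ℂ E)) * ∫⁻ w, g (c • w) ∂μ := by
  set f : E →ₗ[ℝ] E := (c • (LinearMap.id : E →ₗ[ℂ] E)).restrictScalars ℝ with hf
  have hdet : LinearMap.det f = ‖c‖ ^ (2 * Module.finrank ℂ E) := by
    rw [hf, LinearMap.det_restrictScalars, LinearMap.det_smul, LinearMap.det_id, mul_one, map_pow,
      Algebra.norm_complex_apply, Complex.normSq_eq_norm_sq, pow_mul]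
  have hpos : 0 < ‖c‖ ^ (2 * Module.finrank ℂ E) := by positivity
  have h1 := Measure.map_linearMap_addHaar_eq_smul_addHaar μ (f := f) (hdet ▸ hpos.ne')
  have hfm : Measurable f := f.continuous_of_finiteDimensional.measurable
  have h2 : ∫⁻ w, g (c • w) ∂μ = ∫⁻ u, g u ∂(μ.map f) := (lintegral_map hg hfm).symm
  rw [h2, h1, lintegral_smul_measure, hdet, abs_of_pos (inv_pos.2 hpos), smul_eq_mul, ← mul_assoc,
    ← ENNReal.ofReal_mul hpos.le, mul_inv_cancel₀ hpos.ne', ENNReal.ofReal_one, one_mul]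

/-- The moments of the Gaussian density `exp (-|ξ|²)` on `ℂ`. -/
noncomputable def gaussianMoment (N : ℕ) : ℝ≥0∞ :=
  ∫⁻ ξ : ℂ, ENNReal.ofReal (‖ξ‖ ^ (2 * N) * Real.exp (-‖ξ‖ ^ 2))

theorem integral_norm_pow_mul_exp_pos (N : ℕ) :
    0 < ∫ ξ : ℂ, ‖ξ‖ ^ (2 * N) * Real.exp (-‖ξ‖ ^ 2) := by
  have h1 := Complex.integral_rpow_mul_exp_neg_rpow (p := 2) (q := (2 * N : ℕ)) (by norm_num)
    (lt_of_lt_of_le (by norm_num) (Nat.cast_nonneg _))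
  have h2 : ∫ ξ : ℂ, ‖ξ‖ ^ (2 * N) * Real.exp (-‖ξ‖ ^ 2) =
      ∫ ξ : ℂ, ‖ξ‖ ^ ((2 * N : ℕ) : ℝ) * Real.exp (-‖ξ‖ ^ (2 : ℝ)) := by
    refine integral_congr_ae (Filter.Eventually.of_forall fun ξ => ?_)
    simp only [Real.rpow_natCast, Real.rpow_ofNat]
  rw [h2, h1]
  have h3 : 0 < Real.Gamma ((((2 * N : ℕ) : ℝ) + 2) / 2) := Real.Gamma_pos_of_pos (by positivity)
  positivity

theorem integrable_norm_pow_mul_exp (N : ℕ) :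
    Integrable fun ξ : ℂ => ‖ξ‖ ^ (2 * N) * Real.exp (-‖ξ‖ ^ 2) := by
  by_contra h
  exact (integral_norm_pow_mul_exp_pos N).ne' (integral_undef h)

theorem gaussianMoment_eq (N : ℕ) :
    gaussianMoment N = ENNReal.ofReal (∫ ξ : ℂ, ‖ξ‖ ^ (2 * N) * Real.exp (-‖ξ‖ ^ 2)) :=
  (ofReal_integral_eq_lintegral_ofReal (integrable_norm_pow_mul_exp N)
    (Filter.Eventually.of_forall fun ξ => by positivity)).symm

theorem gaussianMoment_ne_zero (N : ℕ) : gaussianMoment N ≠ 0 := by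
  rw [gaussianMoment_eq]
  simpa using integral_norm_pow_mul_exp_pos N

theorem gaussianMoment_ne_top (N : ℕ) : gaussianMoment N ≠ ⊤ := by
  rw [gaussianMoment_eq]
  exact ENNReal.ofReal_ne_top

/-- Substituting ζ = ξ/√S, the power of ‖ζ‖ yields S⁻ᴺ and the area element one more S⁻¹. -/
theorem lintegral_norm_pow_mul_exp_mul (N : ℕ) {S : ℝ} (hS : 0 < S) :
    ∫⁻ ζ : ℂ, ENNReal.ofReal (‖ζ‖ ^ (2 * N) * Real.exp (-(‖ζ‖ ^ 2 * S))) =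
      ENNReal.ofReal (S⁻¹ ^ (N + 1)) * gaussianMoment N := by
  have hr : (((√S)⁻¹ : ℝ) : ℂ) ≠ 0 := by
    exact_mod_cast inv_ne_zero (Real.sqrt_ne_zero'.2 hS)
  have hn : ‖(((√S)⁻¹ : ℝ) : ℂ)‖ ^ 2 = S⁻¹ := by
    rw [Complex.norm_real, norm_inv, Real.norm_of_nonneg (Real.sqrt_nonneg S), inv_pow,
      Real.sq_sqrt hS.le]
  rw [lintegral_eq_mul_lintegral_comp_smul volume hr (by fun_prop), Module.finrank_self,
    mul_one, hn, gaussianMoment, ← lintegral_const_mul _ (by fun_prop),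
    ← lintegral_const_mul _ (by fun_prop)]
  refine lintegral_congr fun ξ => ?_
  rw [← ENNReal.ofReal_mul (by positivity), ← ENNReal.ofReal_mul (by positivity)]
  congr 1
  rw [norm_smul, mul_pow _ _ (2 * N), mul_pow _ _ 2, pow_mul _ 2 N, hn]
  have : S⁻¹ * ‖ξ‖ ^ 2 * S = ‖ξ‖ ^ 2 := by field_simp
  rw [this]
  ring

/-- The Gaussian measure `exp (-‖z‖²) dλ`. -/
noncomputable def gaussianMeasure (ι : Type*) [Fintype ι] : Measure (ι → ℂ) :=
  volume.withDensity fun z => ENNReal.ofReal (Real.exp (-∑ i, ‖z i‖ ^ 2))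

section Gaussian

variable {ι : Type*} [Fintype ι]

theorem lintegral_gaussianMeasure {f : (ι → ℂ) → ℝ≥0∞} (hf : Measurable f) :
    ∫⁻ z, f z ∂gaussianMeasure ι =
      ∫⁻ z, ENNReal.ofReal (Real.exp (-∑ i, ‖z i‖ ^ 2)) * f z := by
  rw [gaussianMeasure, lintegral_withDensity_eq_lintegral_mul _ (by fun_prop) hf]
  rfl

/-- Only the finiteness and positivity of this product matter below. -/
theorem gaussianMeasure_univ : gaussianMeasure ι Set.univ =
    ENNReal.ofReal (∏ _i : ι, ∫ ξ : ℂ, Real.exp (-‖ξ‖ ^ 2)) := by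
  have h1 : ∀ z : ι → ℂ, Real.exp (-∑ i, ‖z i‖ ^ 2) = ∏ i, Real.exp (-‖z i‖ ^ 2) := fun z => by
    rw [← Finset.sum_neg_distrib, Real.exp_sum]
  have h2 : Integrable fun ξ : ℂ => Real.exp (-‖ξ‖ ^ 2) := by
    simpa using integrable_norm_pow_mul_exp 0
  rw [gaussianMeasure, withDensity_apply _ MeasurableSet.univ, Measure.restrict_univ]
  simp only [h1]
  have h3 : Integrable fun z : ι → ℂ => ∏ i, Real.exp (-‖z i‖ ^ 2) :=
    Integrable.fintype_prod fun _ => h2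
  rw [← ofReal_integral_eq_lintegral_ofReal h3
      (Filter.Eventually.of_forall fun z => Finset.prod_nonneg fun i _ => (Real.exp_pos _).le),
    integral_fintype_prod_volume_eq_prod fun _ ξ => Real.exp (-‖ξ‖ ^ 2)]

instance : IsFiniteMeasure (gaussianMeasure ι) :=
  ⟨by rw [gaussianMeasure_univ]; exact ENNReal.ofReal_lt_top⟩

theorem gaussianMeasure_univ_ne_zero : gaussianMeasure ι Set.univ ≠ 0 := by
  have h1 : 0 < ∫ ξ : ℂ, Real.exp (-‖ξ‖ ^ 2) := by
    simpa using integral_norm_pow_mul_exp_pos 0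
  rw [gaussianMeasure_univ, ne_eq, ENNReal.ofReal_eq_zero, not_le]
  exact Finset.prod_pos fun _ _ => h1

/-- The Gaussian density depends on z only through its Euclidean norm. -/
theorem measurePreserving_gaussianMeasure {σ : (ι → ℂ) → ι → ℂ}
    (hσ : MeasurePreserving σ volume volume)
    (hnorm : ∀ z, ∑ i, ‖σ z i‖ ^ 2 = ∑ i, ‖z i‖ ^ 2) :
    MeasurePreserving σ (gaussianMeasure ι) (gaussianMeasure ι) := by
  refine ⟨hσ.measurable, Measure.ext_of_lintegral _ fun f hf => ?_⟩
  have hfσ : Measurable fun z => f (σ z) := hf.comp hσ.measurable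
  rw [lintegral_map hf hσ.measurable, lintegral_gaussianMeasure hfσ,
    lintegral_gaussianMeasure hf,
    ← hσ.lintegral_comp (f := fun z => ENNReal.ofReal (Real.exp (-∑ i, ‖z i‖ ^ 2)) * f z)
      (by fun_prop)]
  simp only [hnorm]

end Gaussian

namespace CP

variable {N : ℕ}

open Classical in
/-- The projection `ℂ^{N+1} ∖ {0} → ℙ^N`, extended by an arbitrary value at `0`. -/
noncomputable def proj (z : Fin (N + 1) → ℂ) : CP N :=
  if hz : z ≠ 0 then mk z hz else mk (lift 0 0) (lift_ne_zero 0 0)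

theorem proj_of_ne_zero {z : Fin (N + 1) → ℂ} (hz : z ≠ 0) : proj z = mk z hz := dif_pos hz

theorem measurable_proj : Measurable (proj (N := N)) := by
  refine measurable_of_measurable_on_compl_singleton 0 ?_
  have : OpensMeasurableSpace {z : Fin (N + 1) → ℂ // z ≠ 0} :=
    Subtype.opensMeasurableSpace {z | z ≠ 0}
  have h1 : Measurable fun z : {z : Fin (N + 1) → ℂ // z ≠ 0} => mk z.1 z.2 :=
    isQuotientMap_mk.continuous.measurable
  have h2 : ({z | z ≠ 0} : Set (Fin (N + 1) → ℂ)).domRestrict proj = fun z => mk z.1 z.2 :=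
    funext fun z => proj_of_ne_zero z.2
  rw [h2]
  exact h1

theorem measurable_chart_symm (k : Fin (N + 1)) : Measurable (chart k).symm :=
  (continuousOn_univ.1 (chart (N := N) k).continuousOn_symm).measurable

theorem proj_smul_lift (k : Fin (N + 1)) (w : Fin N → ℂ) {ζ : ℂ} (hζ : ζ ≠ 0) :
    proj (ζ • lift k w) = (chart k).symm w := by
  have h1 := smul_ne_zero hζ (lift_ne_zero k w)
  rw [proj_of_ne_zero h1, mk_smul _ (lift_ne_zero k w)]
  rfl

theorem insertNth_smul (k : Fin (N + 1)) (w : Fin N → ℂ) (ζ : ℂ) :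
    k.insertNth (α := fun _ => ℂ) ζ (ζ • w) = ζ • lift k w := by
  ext i
  rcases Fin.eq_self_or_eq_succAbove k i with rfl | ⟨j, rfl⟩
  · simp [lift_self]
  · simp [lift_succAbove]

theorem measurable_insertNth (k : Fin (N + 1)) :
    Measurable fun p : ℂ × (Fin N → ℂ) => k.insertNth (α := fun _ => ℂ) p.1 p.2 :=
  (MeasurableEquiv.piFinSuccAbove (fun _ => ℂ) k).symm.measurable

/-- Write z = ζ · `lift k w`. For fixed ζ = z_k the other coordinates are ζw, with Jacobian |ζ|²ᴺ,
and the projection forgets ζ. Integrating ζ out leaves the Fubini-Study density in w. -/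
theorem lintegral_proj_gaussianMeasure (k : Fin (N + 1)) {f : CP N → ℝ≥0∞} (hf : Measurable f) :
    ∫⁻ z, f (proj z) ∂gaussianMeasure (Fin (N + 1)) = gaussianMoment N *
      ∫⁻ w, ENNReal.ofReal ((1 + ∑ i, ‖w i‖ ^ 2)⁻¹ ^ (N + 1)) * f ((chart k).symm w) := by
  have hfp : Measurable fun z => f (proj z) := hf.comp (measurable_proj (N := N))
  have hfc : Measurable fun w => f ((chart k).symm w) := hf.comp (measurable_chart_symm k)
  set g : (Fin (N + 1) → ℂ) → ℝ≥0∞ :=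
    fun z => ENNReal.ofReal (Real.exp (-∑ i, ‖z i‖ ^ 2)) * f (proj z) with hgdef
  have hg : Measurable g := Measurable.mul (by fun_prop) hfp
  obtain ⟨G, hG⟩ : ∃ G : ℂ × (Fin N → ℂ) → ℝ≥0∞,
      G = fun p => g (k.insertNth (α := fun _ => ℂ) p.1 p.2) := ⟨_, rfl⟩
  have hins : Measurable G := hG ▸ hg.comp (measurable_insertNth k)
  have h1 : ∫⁻ z, g z = ∫⁻ ζ : ℂ, ∫⁻ u : Fin N → ℂ, G (ζ, u) := by
    have h2 := (volume_preserving_piFinSuccAbove (fun _ : Fin (N + 1) => ℂ) k).symm.lintegral_comp hg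
    rw [← h2, ← lintegral_prod _ hins.aemeasurable, hG]
    rfl
  have h3 : ∀ ζ : ℂ, ζ ≠ 0 → ∫⁻ u : Fin N → ℂ, G (ζ, u) =
      ∫⁻ w, ENNReal.ofReal (‖ζ‖ ^ (2 * N) * Real.exp (-(‖ζ‖ ^ 2 * (1 + ∑ i, ‖w i‖ ^ 2)))) *
        f ((chart k).symm w) := by
    intro ζ hζ
    have hmeas : Measurable fun u : Fin N → ℂ => G (ζ, u) :=
      hins.comp measurable_prodMk_left
    have hmeas' : Measurable fun w : Fin N → ℂ => G (ζ, ζ • w) :=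
      hmeas.comp (measurable_const_smul ζ)
    rw [lintegral_eq_mul_lintegral_comp_smul volume hζ hmeas, Module.finrank_fin_fun,
      ← lintegral_const_mul _ hmeas']
    refine lintegral_congr fun w => ?_
    rw [hG]
    simp only [hgdef, insertNth_smul, proj_smul_lift k w hζ, Pi.smul_apply, norm_smul, mul_pow,
      ← Finset.mul_sum, sum_norm_sq_lift]
    rw [← mul_assoc, ← ENNReal.ofReal_mul (by positivity)]
  have hswap : Measurable (Function.uncurry fun (ζ : ℂ) (w : Fin N → ℂ) =>
      ENNReal.ofReal (‖ζ‖ ^ (2 * N) * Real.exp (-(‖ζ‖ ^ 2 * (1 + ∑ i, ‖w i‖ ^ 2)))) *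
        f ((chart k).symm w)) :=
    Measurable.mul (by fun_prop) (hfc.comp measurable_snd)
  have hfd : Measurable fun w : Fin N → ℂ =>
      ENNReal.ofReal ((1 + ∑ i, ‖w i‖ ^ 2)⁻¹ ^ (N + 1)) * f ((chart k).symm w) :=
    Measurable.mul (by fun_prop) hfc
  rw [lintegral_gaussianMeasure hfp]
  change ∫⁻ z, g z = _
  -- The substitution u = ζw fails only on the null set ζ = 0.
  rw [h1, lintegral_congr_ae ((Measure.ae_ne volume (0 : ℂ)).mono h3),
    lintegral_lintegral_swap hswap.aemeasurable, ← lintegral_const_mul _ hfd]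
  refine lintegral_congr fun w => ?_
  rw [lintegral_mul_const _ (by fun_prop), lintegral_norm_pow_mul_exp_mul N (by positivity)]
  ring

/-- The right-hand side does not involve k: every single chart already gives the full measure. -/
theorem chartMeasure_fubiniStudy (k : Fin (N + 1)) :
    (fubiniStudy N).chartMeasure (chart k) = (ENNReal.ofReal (2 ^ N) * (gaussianMoment N)⁻¹) •
      (gaussianMeasure (Fin (N + 1))).map proj := by
  refine Measure.ext_of_lintegral _ fun f hf => ?_
  have hfc : Measurable fun w => f ((chart k).symm w) := hf.comp (measurable_chart_symm k)
  have htarget : (chart (N := N) k).target = Set.univ := rfl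
  rw [TwoForm.chartMeasure, htarget, Measure.restrict_univ, lintegral_smul_measure,
    lintegral_map hf measurable_proj, lintegral_proj_gaussianMeasure k hf,
    lintegral_map hf (measurable_chart_symm k)]
  simp only [det_coeffMatrix_fubiniStudy, Complex.ofReal_re]
  have hfd : Measurable fun w : Fin N → ℂ =>
      ENNReal.ofReal ((1 + ∑ i, ‖w i‖ ^ 2)⁻¹ ^ (N + 1)) * f ((chart k).symm w) :=
    Measurable.mul (by fun_prop) hfc
  rw [lintegral_withDensity_eq_lintegral_mul _ (by fun_prop) hfc, smul_eq_mul, mul_assoc,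
    ← mul_assoc _ (gaussianMoment N), ENNReal.inv_mul_cancel (gaussianMoment_ne_zero N)
      (gaussianMoment_ne_top N), one_mul, ← lintegral_const_mul _ hfd]
  refine lintegral_congr fun w => ?_
  rw [← mul_assoc, ← ENNReal.ofReal_mul (by positivity)]
  rfl

/-- The Fubini-Study volume is the image of a multiple of the Gaussian measure. -/
theorem volumeMeasure_fubiniStudy :
    (fubiniStudy N).volumeMeasure = (ENNReal.ofReal (2 ^ N) * (gaussianMoment N)⁻¹) •
      (gaussianMeasure (Fin (N + 1))).map proj := by
  have h1 : atlas (Fin N → ℂ) (CP N) = Set.range chart := rfl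
  rw [TwoForm.volumeMeasure, h1, iSup_range]
  simp only [chartMeasure_fubiniStudy, iSup_const]

end CP

end CoherentStates

/-! ### Spherical means and orthogonality of the linear forms -/

namespace CoherentStates

section Gaussian

variable {ι : Type*} [Fintype ι]

/-- The Gaussian mean of `\bar z_j z_k / ‖z‖²`. -/
noncomputable def sphericalMean (j k : ι) : ℂ :=
  ∫ z, conj (z j) * z k / ((∑ i, ‖z i‖ ^ 2 : ℝ) : ℂ) ∂gaussianMeasure ι

theorem measurable_spherical (j k : ι) :
    Measurable fun z : ι → ℂ => conj (z j) * z k / ((∑ i, ‖z i‖ ^ 2 : ℝ) : ℂ) := by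
  have h1 : Measurable fun z : ι → ℂ => conj (z j) :=
    Complex.continuous_conj.measurable.comp (measurable_pi_apply j)
  have h2 : Measurable fun z : ι → ℂ => ((∑ i, ‖z i‖ ^ 2 : ℝ) : ℂ) :=
    Complex.measurable_ofReal.comp (by fun_prop)
  exact (h1.mul (measurable_pi_apply k)).div h2

theorem sphericalMean_comp {σ : (ι → ℂ) → ι → ℂ} (hσ : MeasurePreserving σ volume volume)
    (hnorm : ∀ z, ∑ i, ‖σ z i‖ ^ 2 = ∑ i, ‖z i‖ ^ 2) (j k : ι) :
    ∫ z, conj (σ z j) * σ z k / ((∑ i, ‖z i‖ ^ 2 : ℝ) : ℂ) ∂gaussianMeasure ι =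
      sphericalMean j k := by
  have hp := measurePreserving_gaussianMeasure hσ hnorm
  have h1 := integral_map hp.measurable.aemeasurable
    (measurable_spherical j k).aestronglyMeasurable (μ := gaussianMeasure ι)
  rw [hp.map_eq] at h1
  rw [sphericalMean, h1]
  simp only [hnorm]

/-- Changing the sign of z_j preserves the Gaussian measure and negates the integrand. -/
theorem sphericalMean_of_ne [DecidableEq ι] {j k : ι} (hjk : j ≠ k) :
    sphericalMean j k = 0 := by
  let ε : ι → ℂ → ℂ := fun i x => if i = j then -x else x
  have hε : ∀ i, MeasurePreserving (ε i) volume volume := fun i => by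
    by_cases hi : i = j
    · simpa only [ε, hi, if_true] using Measure.measurePreserving_neg (volume : Measure ℂ)
    · simp only [ε, hi, if_false]
      exact MeasurePreserving.id (volume : Measure ℂ)
  have h1 := sphericalMean_comp (volume_preserving_pi hε) (fun z => by
    refine Finset.sum_congr rfl fun i _ => ?_
    simp only [ε]
    split_ifs <;> simp) j k
  simp only [ε, if_true, hjk.symm, if_false, map_neg, neg_mul, neg_div, integral_neg] at h1
  rw [← sphericalMean] at h1
  exact self_eq_neg.1 h1.symm

/-- The Gaussian measure is invariant under transposing two coordinates. -/
theorem sphericalMean_self_eq [DecidableEq ι] (j k : ι) :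
    sphericalMean j j = sphericalMean k k := by
  have h1 := volume_measurePreserving_piCongrLeft (fun _ : ι => ℂ) (Equiv.swap j k)
  have h2 : ∀ (z : ι → ℂ) (i : ι), MeasurableEquiv.piCongrLeft (fun _ : ι => ℂ)
      (Equiv.swap j k) z i = z (Equiv.swap j k i) := fun z i => by
    conv_lhs => rw [← Equiv.swap_apply_self j k i]
    exact Equiv.piCongrLeft_apply_apply (fun _ : ι => ℂ) (Equiv.swap j k) z _
  have h3 := sphericalMean_comp h1 (fun z => by
    simp only [h2]
    exact Equiv.sum_comp (Equiv.swap j k) fun i => ‖z i‖ ^ 2) j j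
  simp only [h2, Equiv.swap_apply_left] at h3
  exact h3.symm

theorem ae_gaussianMeasure_ne_zero [Nonempty ι] : ∀ᵐ z ∂gaussianMeasure ι, z ≠ 0 :=
  (withDensity_absolutelyContinuous _ _).ae_le (Measure.ae_ne volume 0)

theorem sum_norm_sq_pos {z : ι → ℂ} (hz : z ≠ 0) : 0 < ∑ i, ‖z i‖ ^ 2 := by
  obtain ⟨i, hi⟩ := Function.ne_iff.1 hz
  refine Finset.sum_pos' (fun i _ => by positivity) ⟨i, Finset.mem_univ i, ?_⟩
  have : z i ≠ 0 := hi
  positivity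

theorem integrable_spherical_self (j : ι) :
    Integrable (fun z => conj (z j) * z j / ((∑ i, ‖z i‖ ^ 2 : ℝ) : ℂ)) (gaussianMeasure ι) := by
  refine Integrable.of_bound (measurable_spherical j j).aestronglyMeasurable 1
    (Filter.Eventually.of_forall fun z => ?_)
  have h1 : ‖z j‖ ^ 2 ≤ ∑ i, ‖z i‖ ^ 2 :=
    Finset.single_le_sum (f := fun i => ‖z i‖ ^ 2) (fun i _ => by positivity) (Finset.mem_univ j)
  rw [norm_div, norm_mul, RCLike.norm_conj, Complex.norm_real,
    Real.norm_of_nonneg (Finset.sum_nonneg fun i _ => by positivity), ← sq]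
  exact div_le_one_of_le₀ h1 (Finset.sum_nonneg fun i _ => by positivity)

/-- The diagonal integrands add up to 1 off the origin, so the equal diagonal means share the total
mass. -/
theorem sphericalMean_self [DecidableEq ι] [Nonempty ι] (j : ι) :
    sphericalMean j j = (((gaussianMeasure ι).real Set.univ / Fintype.card ι : ℝ) : ℂ) := by
  have h1 : ∑ i : ι, sphericalMean i i = ((gaussianMeasure ι).real Set.univ : ℂ) := by
    simp only [sphericalMean]
    rw [← integral_finsetSum _ fun i _ => integrable_spherical_self i]
    have h2 : ∀ᵐ z ∂gaussianMeasure ι,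
        ∑ i, conj (z i) * z i / ((∑ l, ‖z l‖ ^ 2 : ℝ) : ℂ) = 1 := by
      filter_upwards [ae_gaussianMeasure_ne_zero] with z hz
      have h3 : ((∑ l, ‖z l‖ ^ 2 : ℝ) : ℂ) ≠ 0 := by exact_mod_cast (sum_norm_sq_pos hz).ne'
      rw [← Finset.sum_div, div_eq_one_iff_eq h3, ← CP.sum_mul_conj_self]
      exact Finset.sum_congr rfl fun i _ => mul_comm _ _
    rw [integral_congr_ae h2]
    simp
  have h4 : ∑ i : ι, sphericalMean i i = Fintype.card ι * sphericalMean j j := by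
    rw [Finset.sum_congr rfl fun i _ => sphericalMean_self_eq i j]
    simp
  have h5 : (Fintype.card ι : ℂ) ≠ 0 := by exact_mod_cast Fintype.card_ne_zero
  rw [h4] at h1
  push_cast
  rw [← h1]
  field_simp

end Gaussian

namespace CP

variable {N : ℕ}

/-- With l the index of the preferred frame, z_l cancels from conj(z_j/z_l) (z_k/z_l) |z_l|²/‖z‖².
-/
theorem inner_coordSection_mk (j k : Fin (N + 1)) {z : Fin (N + 1) → ℂ} (hz : z ≠ 0) :
    (hyperplaneMetric N).inner (mk z hz) (coordSection j (mk z hz)) (coordSection k (mk z hz)) =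
      conj (z j) * z k / ((∑ i, ‖z i‖ ^ 2 : ℝ) : ℂ) := by
  have hi : z (mk z hz).index ≠ 0 := (mk_mem_affine _ _ hz).1 (mem_affine_index _)
  have hS : ((∑ i, ‖z i‖ ^ 2 : ℝ) : ℂ) ≠ 0 := by exact_mod_cast (sum_norm_sq_pos hz).ne'
  have hn : ∀ l, normSqCoord l (mk z hz) = ‖z l‖ ^ 2 / ∑ i, ‖z i‖ ^ 2 := fun l => by
    obtain ⟨a, ha, h⟩ := exists_smul_rep z hz
    have ha' : ‖a‖ ^ 2 ≠ 0 := by positivity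
    simp only [normSqCoord, h, Pi.smul_apply, smul_eq_mul, norm_mul, mul_pow, ← Finset.mul_sum]
    rw [mul_div_mul_left _ _ ha']
  change scaledInner (normSqCoord (mk z hz).index (mk z hz)) (ratio j (mk z hz).index (mk z hz))
    (ratio k (mk z hz).index (mk z hz)) = _
  rw [scaledInner_apply, hn, ratio_mk, ratio_mk]
  generalize (mk z hz).index = l at *
  have hl : ((‖z l‖ ^ 2 / ∑ i, ‖z i‖ ^ 2 : ℝ) : ℂ) =
      conj (z l) * z l / ((∑ i, ‖z i‖ ^ 2 : ℝ) : ℂ) := by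
    rw [Complex.ofReal_div, ← Complex.normSq_eq_conj_mul_self, Complex.normSq_eq_norm_sq]
  have hi' : conj (z l) ≠ 0 := by simpa using hi
  rw [hl, map_div₀]
  field_simp

theorem sectionInner_coordHolSection (j k : Fin (N + 1)) :
    sectionInner (fubiniStudy N) (hyperplaneMetric N) (coordHolSection j) (coordHolSection k) =
      ((ENNReal.ofReal (2 ^ N) * (gaussianMoment N)⁻¹).toReal : ℂ) * sphericalMean j k := by
  rw [sectionInner, volumeMeasure_fubiniStudy, integral_smul_measure, integral_map
    measurable_proj.aemeasurable ((hyperplaneMetric N).continuous_inner _ _).aestronglyMeasurable,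
    Complex.real_smul, sphericalMean]
  congr 1
  refine integral_congr_ae ?_
  filter_upwards [ae_gaussianMeasure_ne_zero] with z hz
  rw [proj_of_ne_zero hz]
  exact inner_coordSection_mk j k hz

/-- The prefactor is the one in `sectionInner_coordHolSection`, which lets the norms of the Z_j be
expressed by the volume. -/
theorem vol_eq : vol N = (ENNReal.ofReal (2 ^ N) * (gaussianMoment N)⁻¹).toReal *
    (gaussianMeasure (Fin (N + 1))).real Set.univ := by
  rw [vol, volumeMeasure_fubiniStudy, measureReal_ennreal_smul_apply, measureReal_def,
    measureReal_def, Measure.map_apply measurable_proj MeasurableSet.univ, Set.preimage_univ]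

theorem vol_pos : 0 < vol N := by
  rw [vol_eq]
  refine mul_pos (ENNReal.toReal_pos (mul_ne_zero (by simp) ?_) (ENNReal.mul_ne_top
    ENNReal.ofReal_ne_top ?_)) (ENNReal.toReal_pos gaussianMeasure_univ_ne_zero
      (measure_ne_top _ _))
  · exact ENNReal.inv_ne_zero.2 (gaussianMoment_ne_top N)
  · exact ENNReal.inv_ne_top.2 (gaussianMoment_ne_zero N)

/-- The linear forms `Z_j` are orthogonal holomorphic sections of the hyperplane bundle, with
square norm `vol(ℙ^N) / (N + 1)`. -/
theorem isOrthogonalFrame_coordHolSection :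
    IsOrthogonalFrame (fubiniStudy N) (hyperplaneMetric N) coordHolSection (vol N / (N + 1)) where
  span := span_coordHolSection
  ne_zero := (div_pos vol_pos (by positivity)).ne'
  inner_eq j k := by
    rw [sectionInner_coordHolSection]
    split_ifs with hjk
    · subst hjk
      rw [sphericalMean_self, Fintype.card_fin, vol_eq]
      push_cast
      ring
    · rw [sphericalMean_of_ne hjk, mul_zero]

end CP

/-! ### Comparison of the ratios q̂ on M and on ℙ^N -/

section Pullback

variable {n N : ℕ} {M : Type*} [TopologicalSpace M] [ChartedSpace (Fin n → ℂ) M]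
  {L : M → Type*} [∀ x, AddCommGroup (L x)] [∀ x, Module ℂ (L x)]
  [TopologicalSpace (TotalSpace ℂ L)] [∀ x, TopologicalSpace (L x)]
  [FiberBundle ℂ L] [VectorBundle ℂ ℂ L] [ContMDiffVectorBundle ω ℂ L 𝓘(ℂ, Fin n → ℂ)]

theorem quotient_smul_smul {x : M} {q : L x} (hq : q ≠ 0) (a b : ℂ) :
    quotient (a • q) (b • q) = b / a := by
  rw [quotient, fibre_coord_smul, fibre_coord_smul, mul_div_mul_right _ _ (fibre_coord_ne_zero hq)]

/-- The ratio of two linear forms on a line is the ratio of their values at any spanning vector z.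
-/
theorem CP.qHat_coordHolSection (j : Fin (N + 1)) {z : Fin (N + 1) → ℂ} (hz : z ≠ 0)
    (v : CP.H N (CP.mk z hz)) :
    qHat v (CP.coordHolSection j) = z j / CP.pairing v z := by
  have hi : z (CP.mk z hz).index ≠ 0 := (CP.mk_mem_affine _ _ hz).1 (CP.mem_affine_index _)
  have hone : (show CP.H N (CP.mk z hz) from (1 : ℂ)) ≠ 0 := one_ne_zero (α := ℂ)
  have h1 := quotient_smul_smul hone (show ℂ from v)
    (CP.ratio j (CP.mk z hz).index (CP.mk z hz))
  have h2 : ∀ c : ℂ, c • (show CP.H N (CP.mk z hz) from (1 : ℂ)) =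
      (show CP.H N (CP.mk z hz) from c) :=
    fun c => mul_one c
  rw [h2, h2] at h1
  change quotient v (CP.coordSection j (CP.mk z hz)) = _
  refine h1.trans ?_
  rw [CP.pairing, CP.ratio_mk, div_div, mul_comm]

/-- With φ the homogeneous coordinates of i(x) in the chosen frame, both sides are φ_j / t(φ). Where
t vanishes both are 0, by the convention for division by zero. -/
theorem qHat_pullbackSection (hL : BasePointFree n L)
    (s : Module.Basis (Fin (N + 1)) ℂ (HolSection n L)) (t : ∀ p, CP.H N p) (x : M)
    (j : Fin (N + 1)) :
    qHat (pullbackSection hL s t x) (s j) =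
      qHat (t (projMap hL s x)) (CP.coordHolSection j) := by
  have h1 : qHat (t (projMap hL s x)) (CP.coordHolSection j) =
      homCoord s (frame L x x) j / CP.pairing (t (projMap hL s x)) (homCoord s (frame L x x)) :=
    CP.qHat_coordHolSection j (homCoord_ne_zero hL s (frame_ne_zero x)) _
  rw [h1, qHat, pullbackSection]
  conv_lhs => rw [← quotient_smul (frame_ne_zero x) (s j x)]
  exact quotient_smul_smul (frame_ne_zero x) _ _

end Pullback

end CoherentStates


theorem theoremT {n N : ℕ} {M : Type*} [TopologicalSpace M] [ChartedSpace (Fin n → ℂ) M]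
    [IsManifold 𝓘(ℂ, Fin n → ℂ) ω M] [CompactSpace M] [T2Space M]
    [MeasurableSpace M] [BorelSpace M]
    {L : M → Type*} [∀ x, AddCommGroup (L x)] [∀ x, Module ℂ (L x)]
    [TopologicalSpace (TotalSpace ℂ L)] [∀ x, TopologicalSpace (L x)]
    [FiberBundle ℂ L] [VectorBundle ℂ ℂ L] [ContMDiffVectorBundle ω ℂ L 𝓘(ℂ, Fin n → ℂ)]
    (κ : TwoForm n M) (hκ : IsKahlerForm κ)
    (h : HermitianMetric n L) (hquantum : IsQuantum κ h)
    (hL : IsVeryAmple n L)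
    (s : Module.Basis (Fin (N + 1)) ℂ (HolSection n L))
    (hs : ∀ j k, sectionInner κ h (s j) (s k) = if j = k then 1 else 0) :
    (∀ (x : M) (q : L x), q ≠ 0 → ∃! e, IsCoherentVector κ h q e) ∧
    (∀ (p : CP N) (q : CP.H N p), q ≠ 0 →
      ∃! e, IsCoherentVector (CP.fubiniStudy N) (CP.hyperplaneMetric N) q e) ∧
    ∀ t : HolSection N (CP.H N), t ≠ 0 → ∀ x y : M,
      t (projMap hL.basePointFree s x) ≠ 0 → t (projMap hL.basePointFree s y) ≠ 0 →
      coherentInner κ h (pullbackSection hL.basePointFree s t) x y =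
        (CP.vol N / (N + 1) : ℝ) *
          coherentInner (CP.fubiniStudy N) (CP.hyperplaneMetric N) t
            (projMap hL.basePointFree s x) (projMap hL.basePointFree s y) := by
  have hsf : IsOrthogonalFrame κ h s 1 :=
    { span := s.span_eq.ge
      ne_zero := one_ne_zero
      inner_eq := fun j k => by rw [hs, Complex.ofReal_one] }
  have hZ := CP.isOrthogonalFrame_coordHolSection (N := N)
  refine ⟨fun x q _ => hsf.existsUnique_isCoherentVector q,
    fun p q _ => hZ.existsUnique_isCoherentVector q, fun t _ x y _ _ => ?_⟩
  have hv : ((CP.vol N / (N + 1) : ℝ) : ℂ) ≠ 0 := by exact_mod_cast hZ.ne_zero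
  -- The factor vol/(N+1) cancels the c⁻¹ on ℙ^N, while c = 1 on M; the remaining sums agree
  -- termwise.
  rw [hsf.coherentInner_eq, hZ.coherentInner_eq, mul_div_cancel₀ _ hv, Complex.ofReal_one, div_one]
  simp only [qHat_pullbackSection]
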